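/- **Bound on pattern-by-pattern LDA with known $\Sigma$.** Let $d,n\ge 1$, $\mu_1,\mu_{-1}\in\mathbb R^d$, let $\Sigma\in\mathbb R^{d\times d}$ be symmetric positive definite, and let $\eta\in[0,1]$. Let $(X,M,Y)$ be a random element of $\mathbb R^d\times\{0,1\}^d\times\{-1,1\}$ such that $M$ is independent of $(X,Y)$ (MCAR), $\mathbb P(Y=1)=\mathbb P(Y=-1)$, $X\mid Y=k\sim\mathcal N(\mu_k,\Sigma)$ for $k\in\{-1,1\}$, and $M_1,\dots,M_d$ are i.i.d. Bernoulli$(\eta)$. Here $M_j=1$ means that $X_j$ is missing; for $m\in\{0,1\}^d$ put $\mathrm{obs}(m)=\{j: m_j=0\}$, write $x_{\mathrm{obs}(m)}$ for the corresponding subvector of $x$ and $\Sigma_{\mathrm{obs}(m)}$ for the corresponding square block of $\Sigma$, and let $Z=(X_{\mathrm{obs}(M)},M)$. Let $\mathcal D_n=\{(X_{i,\mathrm{obs}(M_i)},M_i,Y_i)\}_{i=1}^n$ be i.i.d. copies of $(X_{\mathrm{obs}(M)},M,Y)$, independent of $(Z,Y)$, and let $$\widehat\mu_{k,j}=\frac{\sum_{i=1}^n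 X_{i,j}\mathbf 1_{Y_i=k}\mathbf 1_{M_{i,j}=0}}{\sum_{i=1}^n \mathbf 1_{Y_i=k}\mathbf 1_{M_{i,j}=0}}\qquad (0/0=0).$$ Let $\widehat h$ be the classifier whose value at $(x_{\mathrm{obs}(m)},m)$ is $$\mathrm{sign}\Big(\big(\widehat\mu_{1,\mathrm{obs}(m)}-\widehat\mu_{-1,\mathrm{obs}(m)}\big)^\top\Sigma_{\mathrm{obs}(m)}^{-1}\Big(x_{\mathrm{obs}(m)}-\tfrac{\widehat\mu_{1,\mathrm{obs}(m)}+\widehat\mu_{-1,\mathrm{obs}(m)}}{2}\Big)\Big),\qquad \mathrm{sign}(t)=\mathbf 1_{t\ge0}-\mathbf 1_{t<0},$$ let $h^\star(Z)=\mathrm{sign}(\mathbb E[Y\mid Z])$ be the Bayes predictor, and let $\mathcal R_{\mathrm{mis}}(h)=\mathbb P(Y\ne h(Z))$, where for $\widehat h$ the probability is also over $\mathcal D_n$. Let $\lambda_{\min}(\Sigma)$ be the smallest eigenvalue of $\Sigma$, $\kappa=\max_j\Sigma_{j,j}/\lambda_{\min}(\Sigma)$ and $\|\mu\|_\infty=\max_{k\in\{-1,1\},\,1\le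 j\le d}|\mu_{k,j}|$. Then $$\mathcal R_{\mathrm{mis}}(\widehat h)-\mathcal R_{\mathrm{mis}}(h^\star)\le \frac{2}{\sqrt{2\pi}}\left(\Big(\frac{1+\eta}{2}\Big)^n\frac{\|\mu\|_\infty^2\,d(1-\eta)}{\lambda_{\min}(\Sigma)}+\frac{4\kappa d}{n}\right)^{1/2}.$$ Consequently there is a universal constant $C>0$ such that, for all $d,\mu_1,\mu_{-1},\Sigma,\eta$ as above, there is an $N$ (depending only on these parameters) such that for all $n\ge N$, $$\mathcal R_{\mathrm{mis}}(\widehat h)-\mathcal R_{\mathrm{mis}}(h^\star)\le C\sqrt{\kappa d/n}.$$ -/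

import Mathlib

open MeasureTheory ProbabilityTheory

noncomputable section

namespace MissingLDA

/-- Missing patterns `m ∈ {0,1}^d`: `m j = true` means that the `j`-th coordinate is missing. -/
abbrev Pattern (d : ℕ) : Type := Fin d → Bool

/-- `obs(m)`: the indices of the coordinates that are observed under the pattern `m`. -/
abbrev Obs {d : ℕ} (m : Pattern d) : Type := {j : Fin d // m j = false}

/-- The space of masked observations: a missing pattern `m` together with a vector indexed by
`obs(m)`, with its disjoint-union sigma-algebra. -/
abbrev MaskedObs (d : ℕ) : Type := Σ m : Pattern d, (Obs m → ℝ)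

/-- The subvector of `x` with indices in `obs(m)`. -/
def subvec {d : ℕ} (m : Pattern d) (x : Fin d → ℝ) : Obs m → ℝ := fun j => x j

/-- The block of `S` with rows and columns in `obs(m)`. -/
def subcov {d : ℕ} (m : Pattern d) (S : Matrix (Fin d) (Fin d) ℝ) : Matrix (Obs m) (Obs m) ℝ :=
  S.submatrix Subtype.val Subtype.val

/-- The masked observation `Z = (X_obs(M), M)`. -/
def observe {Ω : Type*} {d : ℕ} (X : Ω → EuclideanSpace ℝ (Fin d)) (M : Ω → Pattern d) :
    Ω → MaskedObs d :=
  fun ω => ⟨M ω, subvec (M ω) (X ω)⟩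

theorem measurable_observe {Ω : Type*} [MeasurableSpace Ω] {d : ℕ}
    {X : Ω → EuclideanSpace ℝ (Fin d)} {M : Ω → Pattern d}
    (hX : Measurable X) (hM : Measurable M) : Measurable (observe X M) := by
  intro s hs
  have h : observe X M ⁻¹' s =
      ⋃ m : Pattern d, (M ⁻¹' {m}) ∩ ((fun ω => subvec m (X ω)) ⁻¹' ((fun v => (⟨m, v⟩ : MaskedObs d)) ⁻¹' s)) := by
    ext ω
    simp [observe]
  rw [h]
  refine MeasurableSet.iUnion fun m => (hM (measurableSet_singleton m)).inter ?_
  have h1 : Measurable (fun ω => subvec m (X ω)) := by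
    unfold subvec
    fun_prop
  exact h1 (MeasurableSpace.measurableSet_iInf.mp hs m)

/-- The sign with values in the set of labels `{-1, 1}`, which is the type `ℤˣ`; `sgn 0 = 1`. -/
def sgn (t : ℝ) : ℤˣ := if 0 ≤ t then 1 else -1

/-- The number of sample points of class `k` whose `j`-th coordinate is observed. -/
def countObs {d n : ℕ} (D : Fin n → MaskedObs d × ℤˣ) (k : ℤˣ) (j : Fin d) : ℕ :=
  (Finset.univ.filter fun i => (D i).2 = k ∧ (D i).1.1 j = false).card

/-- The average of the observed `j`-th coordinates in class `k` (it is `0` if there is none). -/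
def muHat {d n : ℕ} (D : Fin n → MaskedObs d × ℤˣ) (k : ℤˣ) (j : Fin d) : ℝ :=
  (∑ i, if h : (D i).2 = k ∧ (D i).1.1 j = false then (D i).1.2 ⟨j, h.2⟩ else 0) / countObs D k j

/-- The pattern-by-pattern linear discriminant rule with class means `ν 1`, `ν (-1)` and
covariance `S`. -/
def ldaRule {d : ℕ} (S : Matrix (Fin d) (Fin d) ℝ) (ν : ℤˣ → Fin d → ℝ) (z : MaskedObs d) : ℤˣ :=
  sgn ((subvec z.1 (ν 1) - subvec z.1 (ν (-1))) ⬝ᵥ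
    ((subcov z.1 S)⁻¹).mulVec
      (z.2 - (1 / 2 : ℝ) • (subvec z.1 (ν 1) + subvec z.1 (ν (-1)))))

/-- The plug-in classifier built from the sample `D`, with known covariance `S`. -/
def plugIn {d n : ℕ} (S : Matrix (Fin d) (Fin d) ℝ) (D : Fin n → MaskedObs d × ℤˣ) :
    MaskedObs d → ℤˣ :=
  ldaRule S (muHat D)

section Model

variable {Ω : Type*} [MeasurableSpace Ω] {d n : ℕ}

/-- The misclassification probability of the plug-in classifier; the probability is taken over the
sample and the new point. -/
def plugInMissRisk (P : Measure Ω) (S : Matrix (Fin d) (Fin d) ℝ) (X : Ω → EuclideanSpace ℝ (Fin d))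
    (M : Ω → Pattern d) (Y : Ω → ℤˣ) (D : Fin n → Ω → MaskedObs d × ℤˣ) : ℝ :=
  P.real {ω | Y ω ≠ plugIn S (fun i => D i ω) (observe X M ω)}

/-- The Bayes predictor `sgn (E[Y | Z])` on masked observations. -/
def bayesPredictor (P : Measure Ω) (X : Ω → EuclideanSpace ℝ (Fin d)) (M : Ω → Pattern d)
    (Y : Ω → ℤˣ) : Ω → ℤˣ :=
  fun ω => sgn (condExp (MeasurableSpace.comap (observe X M) inferInstance) P
    (fun ω' => ((Y ω' : ℤ) : ℝ)) ω)

/-- The misclassification probability of the Bayes predictor. -/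
def bayesMissRisk (P : Measure Ω) (X : Ω → EuclideanSpace ℝ (Fin d)) (M : Ω → Pattern d)
    (Y : Ω → ℤˣ) : ℝ :=
  P.real {ω | Y ω ≠ bayesPredictor P X M Y ω}

/-- MCAR missingness: the pattern is independent of the complete data. -/
def IsMCAR (P : Measure Ω) (X : Ω → EuclideanSpace ℝ (Fin d)) (M : Ω → Pattern d)
    (Y : Ω → ℤˣ) : Prop :=
  IndepFun M (fun ω => (X ω, Y ω)) P

/-- Balanced LDA: the classes have equal probability, and `X` given `Y = k` is
`N(μ k, S)` for each class `k`. -/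
def IsBalancedLDA (P : Measure Ω) (μ : ℤˣ → EuclideanSpace ℝ (Fin d))
    (S : Matrix (Fin d) (Fin d) ℝ) (X : Ω → EuclideanSpace ℝ (Fin d)) (Y : Ω → ℤˣ) : Prop :=
  P {ω | Y ω = 1} = P {ω | Y ω = -1} ∧
    ∀ k : ℤˣ, HasLaw X (multivariateGaussian (μ k) S) (ProbabilityTheory.cond P {ω | Y ω = k})

/-- The missingness indicators are independent Bernoulli variables with parameter `η`. -/
def IsBernoulliMissing (P : Measure Ω) (η : ℝ) (M : Ω → Pattern d) : Prop :=
  iIndepFun (fun (j : Fin d) ω => M ω j) P ∧ ∀ j : Fin d, P.real {ω | M ω j = true} = η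

/-- `D` is an i.i.d. sample of incomplete data, distributed as `(Z, Y)` and independent of the new
point `(Z, Y)`. -/
def IsSample (P : Measure Ω) (X : Ω → EuclideanSpace ℝ (Fin d)) (M : Ω → Pattern d) (Y : Ω → ℤˣ)
    (D : Fin n → Ω → MaskedObs d × ℤˣ) : Prop :=
  (∀ i, IdentDistrib (D i) (fun ω => (observe X M ω, Y ω)) P P) ∧
    iIndepFun D P ∧
    IndepFun (fun ω i => D i ω) (fun ω => (observe X M ω, Y ω)) P

end Model

/-- The smallest eigenvalue. -/
def lambdaMin {d : ℕ} (S : Matrix (Fin d) (Fin d) ℝ) : ℝ := sInf (spectrum ℝ S)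

/-- `κ`: the largest diagonal entry over the smallest eigenvalue. -/
def kappa {d : ℕ} (S : Matrix (Fin d) (Fin d) ℝ) : ℝ := (⨆ j : Fin d, S j j) / lambdaMin S

/-- `‖μ‖_∞`: the largest absolute value of a coordinate of one of the two class means. -/
def supMean {d : ℕ} (μ : ℤˣ → EuclideanSpace ℝ (Fin d)) : ℝ :=
  ⨆ p : ℤˣ × Fin d, |μ p.1 p.2|

end MissingLDA

end

open MissingLDA

/-!
For a fixed pattern `m` and a fixed sample, the observed subvectors of the two classes are Gaussian
with means `a₁`, `a₂` and the same covariance `T = Σ_obs(m)`, and the plug-in rule is a half-space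
test with means `b₁`, `b₂`. Write `|v|` for the norm `√(vᵀ T⁻¹ v)`. The score of the plug-in rule is
Gaussian with standard deviation `|b₁ - b₂|`, so the error of the rule is an explicit expression in
the standard normal distribution function `Φ` (`ldaError_eq_cdf`). Since `Φ` is Lipschitz with
constant `1 / √(2π)`, whitening and the triangle inequality bound the excess error over the rule
with the true means by `(|a₁ - b₁| + |a₂ - b₂|) / √(2π)` (`ldaError_sub_le`).

The rule with the true means is a lower bound for the Bayes risk: the likelihood ratio of the two
Gaussians is the exponential of the score (`IsGaussianVector.eq_withDensity`, obtained by comparing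
moment generating functions of linear functionals), so that the Neyman–Pearson argument applies
pattern by pattern (`ldaError_le_of_isGaussianVector`, `ldaRisk_le_bayesMissRisk`).

It remains to average over the pattern and the sample. The bound `|v|² ≤ vᵀv / λ_min(Σ)` reduces the
claim to the mean squared errors of the coordinates of the estimated means. Such an error is
`μ_{k,j}²` if no relevant sample point exists, which has probability `((1 + η) / 2)ⁿ`, and otherwise
a centred average over a random subsample. The latter has second moment at most `2 Σ_{jj} / (n p)`
with `p = (1 - η) / 2` (`integral_sq_subsample_average_le`): given that a point is sampled, the
subsample size is `1 + N'` with `N'` independent of that point, which makes the mixed terms vanish,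
and `p E[1 / (1 + N')] = E[1_{point sampled} / N]`, whose sum over the points is at most `1`. The
factor `1 - η`, the probability that a coordinate of the new point is observed, cancels `p`. Instead
of Jensen's inequality for the square root, `√a ≤ a / (2t) + t / 2` is used, where `t` is the square
root in the claim.
-/

noncomputable section

namespace MissingLDA

/-! ### The standard normal distribution function -/

theorem gaussianPDFReal_zero_one_le (x : ℝ) :
    gaussianPDFReal 0 1 x ≤ 1 / Real.sqrt (2 * Real.pi) := by
  rw [gaussianPDFReal]
  simp only [NNReal.coe_one, mul_one, one_div]
  refine mul_le_of_le_one_right (by positivity) (Real.exp_le_one_iff.mpr ?_)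
  have := sq_nonneg (x - 0)
  linarith

theorem cdf_stdNormal_sub_le {x y : ℝ} (h : x ≤ y) :
    cdf (gaussianReal 0 1) y - cdf (gaussianReal 0 1) x
      ≤ (y - x) / Real.sqrt (2 * Real.pi) := by
  have h1 : cdf (gaussianReal 0 1) y - cdf (gaussianReal 0 1) x
      = (gaussianReal 0 1).real (Set.Ioc x y) := by
    rw [cdf_eq_real, cdf_eq_real, ← Set.Iic_sdiff_Iic,
      measureReal_sdiff (Set.Iic_subset_Iic.mpr h) measurableSet_Iic]
  rw [h1, measureReal_def, gaussianReal_apply 0 one_ne_zero]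
  have h2 : ∫⁻ t in Set.Ioc x y, gaussianPDF 0 1 t
      ≤ ENNReal.ofReal ((y - x) / Real.sqrt (2 * Real.pi)) := by
    calc ∫⁻ t in Set.Ioc x y, gaussianPDF 0 1 t
        ≤ ∫⁻ _ in Set.Ioc x y, ENNReal.ofReal (1 / Real.sqrt (2 * Real.pi)) :=
          lintegral_mono fun t => ENNReal.ofReal_le_ofReal (gaussianPDFReal_zero_one_le t)
      _ = ENNReal.ofReal ((y - x) / Real.sqrt (2 * Real.pi)) := by
          rw [setLIntegral_const, Real.volume_Ioc, ← ENNReal.ofReal_mul (by positivity)]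
          congr 1
          ring
  exact ENNReal.toReal_le_of_le_ofReal
    (div_nonneg (sub_nonneg.mpr h) (Real.sqrt_nonneg _)) h2

theorem cdf_stdNormal_sub_le_abs (x y : ℝ) :
    cdf (gaussianReal 0 1) y - cdf (gaussianReal 0 1) x
      ≤ |y - x| / Real.sqrt (2 * Real.pi) := by
  rcases le_total x y with h | h
  · rw [abs_of_nonneg (sub_nonneg.mpr h)]
    exact cdf_stdNormal_sub_le h
  · have := monotone_cdf (gaussianReal 0 1) h
    have h2 : 0 ≤ |y - x| / Real.sqrt (2 * Real.pi) := by positivity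
    linarith

theorem gaussianReal_Iio_zero (a : ℝ) {s : ℝ} (hs : 0 < s) :
    (gaussianReal a (Real.toNNReal (s ^ 2))).real (Set.Iio 0)
      = cdf (gaussianReal 0 1) (-(a / s)) := by
  have h1 : gaussianReal a (Real.toNNReal (s ^ 2))
      = (gaussianReal 0 1).map (fun x => s * x + a) := by
    have : (fun x => s * x + a) = (fun x => x + a) ∘ (fun x => s * x) := rfl
    rw [this, ← Measure.map_map (by fun_prop) (by fun_prop), gaussianReal_map_const_mul,
      gaussianReal_map_add_const]
    congr 1
    · ring
    · ext; simp [Real.coe_toNNReal _ (sq_nonneg s)]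
  have h2 : (fun x => s * x + a) ⁻¹' (Set.Iio 0) = Set.Iio (-(a / s)) := by
    ext x
    simp only [Set.mem_preimage, Set.mem_Iio]
    rw [← neg_div, lt_div_iff₀ hs]
    constructor <;> intro h <;> linarith
  have : NullSingletonClass (gaussianReal 0 1) := nullSingletonClass_gaussianReal one_ne_zero
  rw [h1, map_measureReal_apply (by fun_prop) measurableSet_Iio, h2, cdf_eq_real]
  exact measureReal_congr Iio_ae_eq_Iic

/-! ### Linear discriminant analysis with Gaussian classes -/

section Gaussian

variable {ι : Type*} [Fintype ι]

/-- `Q` is the Gaussian distribution with mean `m` and covariance `T`, expressed through the laws of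
all linear functionals. -/
def IsGaussianVector (Q : Measure (ι → ℝ)) (m : ι → ℝ) (T : Matrix ι ι ℝ) : Prop :=
  ∀ v : ι → ℝ, Q.map (fun x => v ⬝ᵥ x) = gaussianReal (v ⬝ᵥ m) (Real.toNNReal (v ⬝ᵥ T.mulVec v))

theorem measurable_dotProduct_const (v : ι → ℝ) : Measurable (fun x : ι → ℝ => v ⬝ᵥ x) := by
  unfold dotProduct
  fun_prop

/-- Two finite measures whose linear functionals have the same finite moment generating functions
are equal. -/
theorem measure_eq_of_mgf_dotProduct {Q R : Measure (ι → ℝ)} [IsProbabilityMeasure Q]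
    [IsFiniteMeasure R]
    (hint : ∀ v : ι → ℝ, ∀ t, Integrable (fun x => Real.exp (t * (v ⬝ᵥ x))) Q)
    (h : ∀ v : ι → ℝ, mgf (fun x => v ⬝ᵥ x) Q = mgf (fun x => v ⬝ᵥ x) R) : Q = R := by
  classical
  refine Measure.ext_of_charFunDual (funext fun L => ?_)
  set v : ι → ℝ := fun i => L (Pi.single i 1) with hv
  have hL : ∀ x, L x = v ⬝ᵥ x := by
    intro x
    conv_lhs => rw [← LinearMap.sum_single_apply (fun _ : ι => ℝ) x]
    rw [map_sum]
    simp only [dotProduct, hv]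
    refine Finset.sum_congr rfl fun i _ => ?_
    have : (Pi.single i (x i) : ι → ℝ) = x i • Pi.single i (1 : ℝ) := by
      rw [← Pi.single_smul]; simp
    rw [this, map_smul, smul_eq_mul, mul_comm]
  have hset : integrableExpSet (fun x => v ⬝ᵥ x) Q = Set.univ :=
    Set.eq_univ_of_forall fun t => hint v t
  -- the characteristic function is the complex moment generating function at `I`
  have hc := eqOn_complexMGF_of_mgf (h v)
  have := hc (x := Complex.I) (by simp [hset])
  simp only [complexMGF] at this
  simp only [charFunDual_apply, hL]
  simpa [mul_comm] using this

theorem IsGaussianVector.integrable_exp {Q : Measure (ι → ℝ)} {m : ι → ℝ} {T : Matrix ι ι ℝ}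
    (hQ : IsGaussianVector Q m T) (v : ι → ℝ) (t : ℝ) :
    Integrable (fun x => Real.exp (t * (v ⬝ᵥ x))) Q := by
  have h := integrable_exp_mul_gaussianReal (μ := v ⬝ᵥ m) (v := Real.toNNReal (v ⬝ᵥ T.mulVec v)) t
  rw [← hQ v] at h
  exact h.comp_measurable (measurable_dotProduct_const v)

theorem IsGaussianVector.integral_exp {Q : Measure (ι → ℝ)} {m : ι → ℝ} {T : Matrix ι ι ℝ}
    (hT : T.PosSemidef) (hQ : IsGaussianVector Q m T) (v : ι → ℝ) :
    ∫ x, Real.exp (v ⬝ᵥ x) ∂Q = Real.exp (v ⬝ᵥ m + v ⬝ᵥ T.mulVec v / 2) := by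
  have h := mgf_gaussianReal (hQ v) 1
  have h0 : 0 ≤ v ⬝ᵥ T.mulVec v := by simpa using hT.dotProduct_mulVec_nonneg v
  simpa [mgf, Real.coe_toNNReal _ h0] using h

variable [DecidableEq ι]

/-- The discriminant score of `x` for class means `a`, `b` and covariance `T`. -/
def ldaScore (T : Matrix ι ι ℝ) (a b x : ι → ℝ) : ℝ :=
  (a - b) ⬝ᵥ (T⁻¹).mulVec (x - (1 / 2 : ℝ) • (a + b))

theorem dotProduct_inv_mulVec_comm {T : Matrix ι ι ℝ} (hT : T.PosDef) (u v : ι → ℝ) :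
    u ⬝ᵥ (T⁻¹).mulVec v = v ⬝ᵥ (T⁻¹).mulVec u := by
  have h : (T⁻¹).transpose = T⁻¹ := by
    rw [← Matrix.conjTranspose_eq_transpose_of_trivial]
    exact hT.inv.isHermitian
  rw [Matrix.dotProduct_mulVec, ← Matrix.mulVec_transpose, h, dotProduct_comm]

theorem ldaScore_eq {T : Matrix ι ι ℝ} (hT : T.PosDef) (a b x : ι → ℝ) :
    ldaScore T a b x
      = (T⁻¹).mulVec (a - b) ⬝ᵥ x - (T⁻¹).mulVec (a - b) ⬝ᵥ ((1 / 2 : ℝ) • (a + b)) := by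
  rw [ldaScore, dotProduct_inv_mulVec_comm hT, dotProduct_comm, dotProduct_sub]

theorem measurable_ldaScore {T : Matrix ι ι ℝ} (hT : T.PosDef) (a b : ι → ℝ) :
    Measurable (ldaScore T a b) := by
  have h : ldaScore T a b = fun x => (T⁻¹).mulVec (a - b) ⬝ᵥ x
      - (T⁻¹).mulVec (a - b) ⬝ᵥ ((1 / 2 : ℝ) • (a + b)) := funext (ldaScore_eq hT a b)
  rw [h]
  exact (measurable_dotProduct_const _).sub_const _

theorem mulVec_inv_mulVec {T : Matrix ι ι ℝ} (hT : T.PosDef) (v : ι → ℝ) :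
    T.mulVec ((T⁻¹).mulVec v) = v := by
  rw [Matrix.mulVec_mulVec, Matrix.mul_nonsing_inv _ ((Matrix.isUnit_iff_isUnit_det _).mp hT.isUnit),
    Matrix.one_mulVec]

/-- The likelihood ratio of two Gaussian distributions with the same covariance is the exponential
of the discriminant score. -/
theorem IsGaussianVector.eq_withDensity {Q₁ Q₂ : Measure (ι → ℝ)} [IsProbabilityMeasure Q₁]
    [IsProbabilityMeasure Q₂] {m₁ m₂ : ι → ℝ} {T : Matrix ι ι ℝ} (hT : T.PosDef)
    (h₁ : IsGaussianVector Q₁ m₁ T) (h₂ : IsGaussianVector Q₂ m₂ T) :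
    Q₁ = Q₂.withDensity (fun x => ENNReal.ofReal (Real.exp (ldaScore T m₁ m₂ x))) := by
  set w := (T⁻¹).mulVec (m₁ - m₂) with hw
  set c := w ⬝ᵥ ((1 / 2 : ℝ) • (m₁ + m₂)) with hc
  have hs : ∀ x, ldaScore T m₁ m₂ x = w ⬝ᵥ x - c := ldaScore_eq hT m₁ m₂
  have hmeas : Measurable fun x => Real.exp (ldaScore T m₁ m₂ x) :=
    Real.measurable_exp.comp (measurable_ldaScore hT _ _)
  have hTw : T.mulVec w = m₁ - m₂ := mulVec_inv_mulVec hT _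
  have hint : Integrable (fun x => Real.exp (ldaScore T m₁ m₂ x)) Q₂ := by
    have := (h₂.integrable_exp w 1).mul_const (Real.exp (-c))
    refine this.congr (Filter.Eventually.of_forall fun x => ?_)
    simp only [hs, one_mul, ← Real.exp_add, sub_eq_add_neg]
  have : IsFiniteMeasure
      (Q₂.withDensity (fun x => ENNReal.ofReal (Real.exp (ldaScore T m₁ m₂ x)))) :=
    isFiniteMeasure_withDensity_ofReal hint.2
  have hTt : ∀ u v : ι → ℝ, u ⬝ᵥ T.mulVec v = v ⬝ᵥ T.mulVec u := by
    intro u v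
    have h : T.transpose = T := by
      rw [← Matrix.conjTranspose_eq_transpose_of_trivial]
      exact hT.isHermitian
    rw [Matrix.dotProduct_mulVec, ← Matrix.mulVec_transpose, h, dotProduct_comm]
  refine measure_eq_of_mgf_dotProduct (fun v t => h₁.integrable_exp v t) fun v => funext fun t => ?_
  have e1 : mgf (fun x => v ⬝ᵥ x) Q₁ t
      = Real.exp ((t • v) ⬝ᵥ m₁ + (t • v) ⬝ᵥ T.mulVec (t • v) / 2) := by
    rw [← h₁.integral_exp hT.posSemidef]
    simp [mgf]
  have e2 : mgf (fun x => v ⬝ᵥ x)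
      (Q₂.withDensity (fun x => ENNReal.ofReal (Real.exp (ldaScore T m₁ m₂ x)))) t
      = Real.exp ((t • v + w) ⬝ᵥ m₂ + (t • v + w) ⬝ᵥ T.mulVec (t • v + w) / 2) * Real.exp (-c) := by
    rw [← h₂.integral_exp hT.posSemidef, mgf,
      integral_withDensity_eq_integral_toReal_smul hmeas.ennreal_ofReal (by simp),
      ← integral_mul_const]
    refine integral_congr_ae (Filter.Eventually.of_forall fun x => ?_)
    simp only [hs, ENNReal.toReal_ofReal (Real.exp_pos _).le, smul_eq_mul, ← Real.exp_add]
    congr 1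
    simp only [add_dotProduct, smul_dotProduct, smul_eq_mul]
    ring
  rw [e1, e2, ← Real.exp_add]
  congr 1
  -- completing the square: tilting by `w` shifts the mean by `T w = m₁ - m₂`
  have hm : m₁ = m₂ + T.mulVec w := by rw [hTw]; abel
  rw [hc, hm]
  simp only [Matrix.mulVec_add, Matrix.mulVec_smul, add_dotProduct, dotProduct_add, smul_dotProduct,
    dotProduct_smul, smul_eq_mul, hTt w v]
  ring

/-- The balanced misclassification probability of the linear discriminant rule with class means
`a`, `b` and covariance `T`, when the true class distributions are `Q₁` and `Q₂`. -/
def ldaError (Q₁ Q₂ : Measure (ι → ℝ)) (T : Matrix ι ι ℝ) (a b : ι → ℝ) : ℝ :=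
  (Q₁.real {x | ldaScore T a b x < 0} + Q₂.real {x | 0 ≤ ldaScore T a b x}) / 2

/-- **Neyman–Pearson**: no test beats the discriminant rule with the true means. -/
theorem ldaError_le_of_isGaussianVector {Q₁ Q₂ : Measure (ι → ℝ)} [IsProbabilityMeasure Q₁]
    [IsProbabilityMeasure Q₂] {m₁ m₂ : ι → ℝ} {T : Matrix ι ι ℝ} (hT : T.PosDef)
    (h₁ : IsGaussianVector Q₁ m₁ T) (h₂ : IsGaussianVector Q₂ m₂ T) {U : Set (ι → ℝ)}
    (hU : MeasurableSet U) :
    ldaError Q₁ Q₂ T m₁ m₂ ≤ (Q₁.real Uᶜ + Q₂.real U) / 2 := by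
  have hms := measurable_ldaScore hT m₁ m₂
  set A : Set (ι → ℝ) := {x | 0 ≤ ldaScore T m₁ m₂ x} with hA
  have hAm : MeasurableSet A := measurableSet_le measurable_const hms
  have hAc : {x | ldaScore T m₁ m₂ x < 0} = Aᶜ := by ext x; simp [hA]
  have hd := h₁.eq_withDensity hT h₂
  have key1 : Q₂ (A \ U) ≤ Q₁ (A \ U) := by
    conv_rhs => rw [hd]
    rw [withDensity_apply _ (hAm.diff hU)]
    calc Q₂ (A \ U) = ∫⁻ _ in A \ U, 1 ∂Q₂ := by simp
      _ ≤ _ := by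
        refine setLIntegral_mono' (hAm.diff hU) fun x hx => ?_
        rw [← ENNReal.ofReal_one]
        exact ENNReal.ofReal_le_ofReal (Real.one_le_exp hx.1)
  have key2 : Q₁ (U \ A) ≤ Q₂ (U \ A) := by
    conv_lhs => rw [hd]
    rw [withDensity_apply _ (hU.diff hAm)]
    calc _ ≤ ∫⁻ _ in U \ A, 1 ∂Q₂ := by
            refine setLIntegral_mono' (hU.diff hAm) fun x hx => ?_
            rw [← ENNReal.ofReal_one]
            have : ldaScore T m₁ m₂ x < 0 := by simpa [hA] using hx.2
            exact ENNReal.ofReal_le_ofReal (Real.exp_le_one_iff.mpr this.le)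
      _ = Q₂ (U \ A) := by simp
  have k1 : Q₂.real (A \ U) ≤ Q₁.real (A \ U) := ENNReal.toReal_mono (by simp) key1
  have k2 : Q₁.real (U \ A) ≤ Q₂.real (U \ A) := ENNReal.toReal_mono (by simp) key2
  have s1 := measureReal_inter_add_sdiff (μ := Q₁) (s := A) hU
  have s2 := measureReal_inter_add_sdiff (μ := Q₁) (s := U) hAm
  have s3 := measureReal_inter_add_sdiff (μ := Q₂) (s := A) hU
  have s4 := measureReal_inter_add_sdiff (μ := Q₂) (s := U) hAm
  rw [Set.inter_comm] at s2 s4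
  rw [ldaError, hAc, measureReal_compl hAm, measureReal_compl hU]
  linarith

/-- The norm of the whitened vector `T^{-1/2} v`. -/
def whitenedNorm (T : Matrix ι ι ℝ) (v : ι → ℝ) : ℝ :=
  Real.sqrt (v ⬝ᵥ (T⁻¹).mulVec v)

/-- The misclassification probability of a discriminant rule through the normal distribution
function. If the two class means agree, both quotients are `0` by convention and the formula still
gives the error `1 / 2` of a constant rule. -/
theorem ldaError_eq_cdf {Q₁ Q₂ : Measure (ι → ℝ)} [IsProbabilityMeasure Q₁]
    [IsProbabilityMeasure Q₂] {m₁ m₂ : ι → ℝ} {T : Matrix ι ι ℝ} (hT : T.PosDef)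
    (h₁ : IsGaussianVector Q₁ m₁ T) (h₂ : IsGaussianVector Q₂ m₂ T) (a b : ι → ℝ) :
    ldaError Q₁ Q₂ T a b = 1 / 2
      + (cdf (gaussianReal 0 1) (-(ldaScore T a b m₁ / whitenedNorm T (a - b)))
        - cdf (gaussianReal 0 1) (-(ldaScore T a b m₂ / whitenedNorm T (a - b)))) / 2 := by
  have hms := measurable_ldaScore hT a b
  have hAm : MeasurableSet {x | ldaScore T a b x < 0} := measurableSet_lt hms measurable_const
  have hAc : {x | 0 ≤ ldaScore T a b x} = {x | ldaScore T a b x < 0}ᶜ := by ext x; simp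
  rw [ldaError, hAc, measureReal_compl hAm, probReal_univ]
  by_cases hab : a - b = 0
  · simp [ldaScore, hab, whitenedNorm]
  have hpos : 0 < (a - b) ⬝ᵥ (T⁻¹).mulVec (a - b) := by
    simpa using hT.inv.dotProduct_mulVec_pos hab
  have hs : 0 < whitenedNorm T (a - b) := Real.sqrt_pos.mpr hpos
  have key : ∀ (Q : Measure (ι → ℝ)) (m : ι → ℝ), IsGaussianVector Q m T →
      Q.real {x | ldaScore T a b x < 0}
        = cdf (gaussianReal 0 1) (-(ldaScore T a b m / whitenedNorm T (a - b))) := by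
    intro Q m hQ
    rw [← gaussianReal_Iio_zero _ hs]
    have hv : (T⁻¹).mulVec (a - b) ⬝ᵥ T.mulVec ((T⁻¹).mulVec (a - b))
        = whitenedNorm T (a - b) ^ 2 := by
      rw [mulVec_inv_mulVec hT, whitenedNorm, Real.sq_sqrt hpos.le, dotProduct_comm]
    have hmap : Q.map (ldaScore T a b)
        = gaussianReal (ldaScore T a b m) (Real.toNNReal (whitenedNorm T (a - b) ^ 2)) := by
      have : ldaScore T a b = (fun t => t - (T⁻¹).mulVec (a - b) ⬝ᵥ ((1 / 2 : ℝ) • (a + b)))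
          ∘ (fun x => (T⁻¹).mulVec (a - b) ⬝ᵥ x) := funext (ldaScore_eq hT a b)
      rw [ldaScore_eq hT a b m, this, ← Measure.map_map (by fun_prop) (measurable_dotProduct_const _),
        hQ, gaussianReal_map_sub_const, hv]
    rw [← hmap, map_measureReal_apply hms measurableSet_Iio]
    rfl
  rw [key Q₁ m₁ h₁, key Q₂ m₂ h₂]
  ring

/-- In an inner product space, the normalised score of the first true mean differs from half the
distance of the true means by at most the estimation errors. -/
theorem abs_inner_div_norm_sub_le {E : Type*} [NormedAddCommGroup E] [InnerProductSpace ℝ E]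
    (a b u v : E) :
    |inner ℝ (a - b) (u - (1 / 2 : ℝ) • (a + b)) / ‖a - b‖ - ‖u - v‖ / 2|
      ≤ ‖u - a‖ + (‖u - a‖ + ‖v - b‖) / 2 := by
  have h1 : inner ℝ (a - b) (u - (1 / 2 : ℝ) • (a + b))
      = inner ℝ (a - b) (u - a) + ‖a - b‖ ^ 2 / 2 := by
    have : u - (1 / 2 : ℝ) • (a + b) = (u - a) + (1 / 2 : ℝ) • (a - b) := by
      module
    rw [this, inner_add_right, inner_smul_right, real_inner_self_eq_norm_sq]
    ring
  have h2 : |inner ℝ (a - b) (u - a) / ‖a - b‖| ≤ ‖u - a‖ := by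
    rw [abs_div, abs_norm]
    refine div_le_of_le_mul₀ (norm_nonneg _) (norm_nonneg _) ?_
    rw [mul_comm]
    exact abs_real_inner_le_norm _ _
  have h3 : |‖a - b‖ - ‖u - v‖| ≤ ‖u - a‖ + ‖v - b‖ := by
    refine (abs_norm_sub_norm_le _ _).trans ?_
    have : (a - b) - (u - v) = (v - b) - (u - a) := by abel
    rw [this, add_comm]
    exact norm_sub_le _ _
  have h4 : ‖a - b‖ ^ 2 / 2 / ‖a - b‖ = ‖a - b‖ / 2 := by
    rcases eq_or_ne ‖a - b‖ 0 with h | h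
    · simp [h]
    · field_simp
  rw [h1, add_div, h4]
  have : inner ℝ (a - b) (u - a) / ‖a - b‖ + ‖a - b‖ / 2 - ‖u - v‖ / 2
      = inner ℝ (a - b) (u - a) / ‖a - b‖ + (‖a - b‖ - ‖u - v‖) / 2 := by ring
  rw [this]
  refine (abs_add_le _ _).trans (add_le_add h2 ?_)
  rw [abs_div, abs_two]
  linarith

open scoped MatrixOrder in
theorem abs_ldaScore_div_sub_le {T : Matrix ι ι ℝ} (hT : T.PosDef) (a b u v : ι → ℝ) :
    |ldaScore T a b u / whitenedNorm T (a - b) - whitenedNorm T (u - v) / 2|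
      ≤ whitenedNorm T (u - a) + (whitenedNorm T (u - a) + whitenedNorm T (v - b)) / 2 := by
  obtain ⟨B, hB⟩ : ∃ B : Matrix ι ι ℝ, T⁻¹ = B.transpose * B := by
    refine ⟨CFC.sqrt T⁻¹, ?_⟩
    have h : (CFC.sqrt T⁻¹).transpose = CFC.sqrt T⁻¹ := by
      rw [← Matrix.conjTranspose_eq_transpose_of_trivial]
      exact (CFC.sqrt_nonneg T⁻¹).isSelfAdjoint
    rw [h, CFC.sqrt_mul_sqrt_self _ hT.inv.posSemidef.nonneg]
  let f : (ι → ℝ) →ₗ[ℝ] EuclideanSpace ℝ ι :=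
    (WithLp.linearEquiv 2 ℝ (ι → ℝ)).symm.toLinearMap ∘ₗ Matrix.mulVecLin B
  have hin : ∀ x y : ι → ℝ, x ⬝ᵥ (T⁻¹).mulVec y = inner ℝ (f x) (f y) := by
    intro x y
    rw [hB, ← Matrix.mulVec_mulVec, Matrix.dotProduct_mulVec, Matrix.vecMul_transpose]
    simp [f, EuclideanSpace.inner_eq_star_dotProduct, dotProduct_comm]
  have hn : ∀ x, whitenedNorm T x = ‖f x‖ := by
    intro x
    rw [whitenedNorm, hin, real_inner_self_eq_norm_sq, Real.sqrt_sq (norm_nonneg _)]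
  simp only [hn, ldaScore, hin, map_sub, map_smul, map_add]
  exact abs_inner_div_norm_sub_le _ _ _ _

theorem whitenedNorm_neg (T : Matrix ι ι ℝ) (v : ι → ℝ) :
    whitenedNorm T (-v) = whitenedNorm T v := by
  simp [whitenedNorm, Matrix.mulVec_neg]

/-- The excess error of a discriminant rule with wrong means is controlled by the whitened
estimation errors. -/
theorem ldaError_sub_le {Q₁ Q₂ : Measure (ι → ℝ)} [IsProbabilityMeasure Q₁]
    [IsProbabilityMeasure Q₂] {m₁ m₂ : ι → ℝ} {T : Matrix ι ι ℝ} (hT : T.PosDef)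
    (h₁ : IsGaussianVector Q₁ m₁ T) (h₂ : IsGaussianVector Q₂ m₂ T) (a b : ι → ℝ) :
    ldaError Q₁ Q₂ T a b - ldaError Q₁ Q₂ T m₁ m₂
      ≤ (whitenedNorm T (m₁ - a) + whitenedNorm T (m₂ - b)) / Real.sqrt (2 * Real.pi) := by
  have swap : ∀ a b x, ldaScore T a b x = -ldaScore T b a x := by
    intro a b x
    rw [ldaScore, ldaScore, add_comm b a, ← neg_sub b a, neg_dotProduct]
  have nswap : ∀ a b, whitenedNorm T (a - b) = whitenedNorm T (b - a) := by
    intro a b; rw [← whitenedNorm_neg, neg_sub]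
  -- the normalised scores at the true means are half their whitened distance, up to sign
  have ht1 : ldaScore T m₁ m₂ m₁ / whitenedNorm T (m₁ - m₂) = whitenedNorm T (m₁ - m₂) / 2 := by
    have := abs_ldaScore_div_sub_le hT m₁ m₂ m₁ m₂
    simpa [whitenedNorm, sub_eq_zero] using this
  have ht2 : ldaScore T m₁ m₂ m₂ / whitenedNorm T (m₁ - m₂) = -(whitenedNorm T (m₁ - m₂) / 2) := by
    have := abs_ldaScore_div_sub_le hT m₂ m₁ m₂ m₁
    have : ldaScore T m₂ m₁ m₂ / whitenedNorm T (m₂ - m₁) = whitenedNorm T (m₂ - m₁) / 2 := by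
      simpa [whitenedNorm, sub_eq_zero] using this
    rw [swap, nswap m₁ m₂, neg_div, this]
  have e1 := abs_ldaScore_div_sub_le hT a b m₁ m₂
  have e2 := abs_ldaScore_div_sub_le hT b a m₂ m₁
  rw [swap, nswap b a, nswap m₂ m₁, neg_div] at e2
  rw [ldaError_eq_cdf hT h₁ h₂, ldaError_eq_cdf hT h₁ h₂, ht1, ht2]
  set r := whitenedNorm T (m₁ - m₂)
  set p := ldaScore T a b m₁ / whitenedNorm T (a - b)
  set q := ldaScore T a b m₂ / whitenedNorm T (a - b)
  have c1 := cdf_stdNormal_sub_le_abs (-(r / 2)) (-p)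
  have c2 := cdf_stdNormal_sub_le_abs (-q) (-(-(r / 2)))
  have a1 : |-p - -(r / 2)| = |p - r / 2| := by rw [← abs_neg]; congr 1; ring
  have a2 : |-(-(r / 2)) - -q| = |-q - r / 2| := by rw [← abs_neg]; congr 1; ring
  rw [a1] at c1
  rw [a2] at c2
  have hpi : 0 < Real.sqrt (2 * Real.pi) := by positivity
  have d1 := div_le_div_of_nonneg_right e1 hpi.le
  have d2 := div_le_div_of_nonneg_right e2 hpi.le
  have : (whitenedNorm T (m₁ - a) + whitenedNorm T (m₂ - b)) / Real.sqrt (2 * Real.pi)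
    = ((whitenedNorm T (m₁ - a) + (whitenedNorm T (m₁ - a) + whitenedNorm T (m₂ - b)) / 2)
        / Real.sqrt (2 * Real.pi)
      + (whitenedNorm T (m₂ - b) + (whitenedNorm T (m₂ - b) + whitenedNorm T (m₁ - a)) / 2)
        / Real.sqrt (2 * Real.pi)) / 2 := by ring
  rw [this]
  linarith

end Gaussian

/-! ### The smallest eigenvalue -/

section Eigenvalue

variable {d : ℕ} {S : Matrix (Fin d) (Fin d) ℝ}

theorem lambdaMin_pos (hd : 0 < d) (hS : S.PosDef) : 0 < lambdaMin S := by
  have hfin : (spectrum ℝ S).Finite := Matrix.finite_real_spectrum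
  have hne : (spectrum ℝ S).Nonempty :=
    ⟨_, hS.isHermitian.eigenvalues_mem_spectrum_real ⟨0, hd⟩⟩
  have hmem := hne.csInf_mem hfin
  rw [hS.isHermitian.spectrum_real_eq_range_eigenvalues] at hmem
  obtain ⟨i, hi⟩ := hmem
  rw [lambdaMin, hS.isHermitian.spectrum_real_eq_range_eigenvalues, ← hi]
  exact hS.eigenvalues_pos i

theorem lambdaMin_mul_le (hS : S.PosDef) (v : Fin d → ℝ) :
    lambdaMin S * (v ⬝ᵥ v) ≤ v ⬝ᵥ S.mulVec v := by
  have hfin : (spectrum ℝ S).Finite := Matrix.finite_real_spectrum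
  have hps : (S - algebraMap ℝ (Matrix (Fin d) (Fin d) ℝ) (lambdaMin S)).PosSemidef := by
    rw [Matrix.posSemidef_iff_isHermitian_and_spectrum_nonneg]
    refine ⟨?_, ?_⟩
    · refine hS.isHermitian.sub ?_
      rw [Matrix.algebraMap_eq_diagonal]
      exact Matrix.isHermitian_diagonal _
    · intro a ha
      rw [← spectrum.sub_singleton_eq] at ha
      obtain ⟨b, hb, c, hc, rfl⟩ := ha
      rw [Set.mem_singleton_iff] at hc
      subst hc
      exact sub_nonneg.mpr (csInf_le hfin.bddBelow hb)
  have := hps.dotProduct_mulVec_nonneg v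
  simp only [star_trivial, Matrix.sub_mulVec, dotProduct_sub, Algebra.algebraMap_eq_smul_one,
    Matrix.smul_mulVec, Matrix.one_mulVec, dotProduct_smul, smul_eq_mul] at this
  linarith

theorem dotProduct_inv_mulVec_le {ι : Type*} [Fintype ι] [DecidableEq ι] {T : Matrix ι ι ℝ}
    (hT : T.PosDef) {c : ℝ} (hc : 0 < c) (h : ∀ y : ι → ℝ, c * (y ⬝ᵥ y) ≤ y ⬝ᵥ T.mulVec y)
    (v : ι → ℝ) : v ⬝ᵥ (T⁻¹).mulVec v ≤ (v ⬝ᵥ v) / c := by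
  set y := (T⁻¹).mulVec v with hy
  have h1 : y ⬝ᵥ T.mulVec y = v ⬝ᵥ y := by rw [hy, mulVec_inv_mulVec hT, dotProduct_comm]
  have h2 := h y
  rw [h1] at h2
  -- expand `0 ≤ |v - c • y|²`
  have h3 : 0 ≤ (v - c • y) ⬝ᵥ (v - c • y) := by
    simpa using dotProduct_star_self_nonneg (v - c • y)
  simp only [sub_dotProduct, dotProduct_sub, smul_dotProduct, dotProduct_smul, smul_eq_mul,
    dotProduct_comm y v] at h3
  rw [le_div_iff₀ hc]
  nlinarith

end Eigenvalue

/-! ### Patterns and subvectors -/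

section Patterns

variable {d : ℕ} {m : Pattern d} {S : Matrix (Fin d) (Fin d) ℝ}

/-- The extension of a vector indexed by `obs(m)` by zero. -/
def zeroExtend (m : Pattern d) (y : Obs m → ℝ) : Fin d → ℝ :=
  fun j => if h : m j = false then y ⟨j, h⟩ else 0

theorem subvec_zeroExtend (y : Obs m → ℝ) : subvec m (zeroExtend m y) = y := by
  ext j
  simp [subvec, zeroExtend, j.2]

theorem zeroExtend_dotProduct (y : Obs m → ℝ) (g : Fin d → ℝ) :
    zeroExtend m y ⬝ᵥ g = y ⬝ᵥ subvec m g := by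
  rw [dotProduct, ← Fintype.sum_subtype_add_sum_subtype (fun j => m j = false)]
  have h : ∑ j : {j // ¬ m j = false}, zeroExtend m y j * g j = 0 :=
    Finset.sum_eq_zero fun j _ => by simp [zeroExtend, j.2]
  rw [h, add_zero]
  refine Finset.sum_congr rfl fun j _ => ?_
  simp [zeroExtend, j.2, subvec]

theorem subvec_mulVec_zeroExtend (y : Obs m → ℝ) :
    subvec m (S.mulVec (zeroExtend m y)) = (subcov m S).mulVec y := by
  ext j
  rw [subvec, Matrix.mulVec, dotProduct_comm, zeroExtend_dotProduct, dotProduct_comm]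
  rfl

theorem zeroExtend_quadratic (y : Obs m → ℝ) :
    zeroExtend m y ⬝ᵥ S.mulVec (zeroExtend m y) = y ⬝ᵥ (subcov m S).mulVec y := by
  rw [zeroExtend_dotProduct, subvec_mulVec_zeroExtend]

theorem posDef_subcov (hS : S.PosDef) : (subcov m S).PosDef :=
  hS.submatrix Subtype.val_injective

/-- The squared whitened norm is at most the squared Euclidean norm over the smallest eigenvalue. -/
theorem whitenedNorm_sq_le (hd : 0 < d) (hS : S.PosDef) (v : Obs m → ℝ) :
    whitenedNorm (subcov m S) v ^ 2 ≤ (v ⬝ᵥ v) / lambdaMin S := by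
  rw [whitenedNorm, Real.sq_sqrt (by simpa using
    (posDef_subcov (m := m) hS).inv.posSemidef.dotProduct_mulVec_nonneg v)]
  refine dotProduct_inv_mulVec_le (posDef_subcov hS) (lambdaMin_pos hd hS) (fun y => ?_) v
  have h := lambdaMin_mul_le hS (zeroExtend m y)
  rwa [zeroExtend_quadratic, zeroExtend_dotProduct, subvec_zeroExtend] at h

theorem measurable_subvec : Measurable (fun x : EuclideanSpace ℝ (Fin d) => subvec m x) := by
  unfold subvec
  fun_prop

/-- The observed part of a Gaussian vector is Gaussian. -/
theorem isGaussianVector_map_subvec (hS : S.PosDef) (ν : EuclideanSpace ℝ (Fin d)) :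
    IsGaussianVector
      ((multivariateGaussian ν S).map (fun x : EuclideanSpace ℝ (Fin d) => subvec m x)) (subvec m ν)
      (subcov m S) := by
  intro v
  set u : EuclideanSpace ℝ (Fin d) := WithLp.toLp 2 (zeroExtend m v) with hu
  have hux : ∀ x : EuclideanSpace ℝ (Fin d), innerSL ℝ u x = v ⬝ᵥ subvec m x := by
    intro x
    rw [innerSL_apply_apply, EuclideanSpace.inner_eq_star_dotProduct, dotProduct_comm]
    simp only [star_trivial, hu]
    exact zeroExtend_dotProduct v x
  rw [Measure.map_map (measurable_dotProduct_const v) measurable_subvec]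
  have hfun : (fun x : Obs m → ℝ => v ⬝ᵥ x) ∘ (fun x : EuclideanSpace ℝ (Fin d) => subvec m x)
      = innerSL ℝ u := funext fun x => (hux x).symm
  rw [hfun, IsGaussian.map_eq_gaussianReal,
    (innerSL ℝ u).integral_comp_id_comm IsGaussian.integrable_id,
    integral_id_multivariateGaussian, hux]
  congr 2
  rw [← zeroExtend_quadratic]
  have h := covarianceBilin_multivariateGaussian (μ := ν) hS.posSemidef u u
  rw [covarianceBilin_self IsGaussian.memLp_two_id] at h
  exact h

end Patterns

/-! ### Mean squared error of an average over a random subsample -/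

/-- One variable of an independent family is independent of the tuple of all the others. -/
theorem indepFun_leaveOneOut {Ω ι α : Type*} [MeasurableSpace Ω] {P : Measure Ω} [Fintype ι]
    [DecidableEq ι] [MeasurableSpace α] {ξ : ι → Ω → α} (hξ : iIndepFun ξ P)
    (hm : ∀ i, Measurable (ξ i)) (i : ι) :
    IndepFun (ξ i) (fun ω (r : ({i}ᶜ : Finset ι)) => ξ r ω) P := by
  have h := hξ.indepFun_finset {i} {i}ᶜ disjoint_compl_right hm
  exact h.comp (φ := fun f : ({i} : Finset ι) → α => f ⟨i, Finset.mem_singleton_self i⟩) (ψ := id)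
    (measurable_pi_apply _) measurable_id

/-- The average of `g (ξ i)` over the random subsample `b (ξ i) = 1` has second moment at most
`2 c / (n p)`, if `p` is the sampling probability and `g (ξ i)` is centred with second moment
`c p`. The average over an empty subsample is `0`. -/
theorem integral_sq_subsample_average_le {Ω : Type*} [MeasurableSpace Ω] {P : Measure Ω}
    [IsProbabilityMeasure P] {α : Type*} [MeasurableSpace α] {n : ℕ} (hn : 0 < n)
    {ξ : Fin n → Ω → α} {b g : α → ℝ}
    (hξ : iIndepFun ξ P) (hm : ∀ i, Measurable (ξ i)) (hb : Measurable b) (hg : Measurable g)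
    (hb01 : ∀ z, b z = 0 ∨ b z = 1) (hgb : ∀ z, b z = 0 → g z = 0)
    {p c : ℝ} (hp : 0 < p) (hc : 0 ≤ c)
    (hEb : ∀ i, ∫ ω, b (ξ i ω) ∂P = p) (hEg : ∀ i, ∫ ω, g (ξ i ω) ∂P = 0)
    (hg2 : ∀ i, MemLp (fun ω => g (ξ i ω)) 2 P)
    (hEg2 : ∀ i, ∫ ω, g (ξ i ω) ^ 2 ∂P = c * p) :
    Integrable (fun ω => ((∑ i, g (ξ i ω)) / ∑ i, b (ξ i ω)) ^ 2) P ∧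
    ∫ ω, ((∑ i, g (ξ i ω)) / ∑ i, b (ξ i ω)) ^ 2 ∂P ≤ 2 * c / (n * p) := by
  have hb0 : ∀ z, 0 ≤ b z := fun z => by rcases hb01 z with h | h <;> simp [h]
  have hb1 : ∀ z, b z ≤ 1 := fun z => by rcases hb01 z with h | h <;> simp [h]
  set N : Ω → ℝ := fun ω => ∑ i, b (ξ i ω) with hN
  -- the subsample size without the `i`-th point
  set N' : Fin n → Ω → ℝ := fun i ω => ∑ r ∈ {i}ᶜ, b (ξ r ω) with hN'
  have hsplit : ∀ i ω, N ω = b (ξ i ω) + N' i ω := fun i ω => by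
    simp only [hN, hN']
    rw [← Finset.sum_add_sum_compl {i}, Finset.sum_singleton]
  have hN'0 : ∀ i ω, 0 ≤ N' i ω := fun i ω => Finset.sum_nonneg fun r _ => hb0 _
  have hN0 : ∀ ω, 0 ≤ N ω := fun ω => Finset.sum_nonneg fun r _ => hb0 _
  have hNm : Measurable N := Finset.measurable_sum _ fun i _ => hb.comp (hm i)
  have hN'm : ∀ i, Measurable (N' i) := fun i => Finset.measurable_sum _ fun r _ => hb.comp (hm r)
  have hgm : ∀ i, Measurable fun ω => g (ξ i ω) := fun i => hg.comp (hm i)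
  -- independence of the `i`-th point and a function of all the others
  have hind : ∀ (i : Fin n) (f : α → ℝ) (F : (({i}ᶜ : Finset (Fin n)) → α) → ℝ), Measurable f →
      Measurable F → ∫ ω, f (ξ i ω) * F (fun r => ξ r ω) ∂P
        = (∫ ω, f (ξ i ω) ∂P) * ∫ ω, F (fun r => ξ r ω) ∂P := by
    intro i f F hf hF
    refine IndepFun.integral_fun_mul_eq_mul_integral
      ((indepFun_leaveOneOut hξ hm i).comp hf hF) ?_ ?_
    · exact (hf.comp (hm i)).aestronglyMeasurable
    · exact (hF.comp (measurable_pi_lambda _ fun r => hm r)).aestronglyMeasurable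
  have hN'F : ∀ i, Measurable fun x : ({i}ᶜ : Finset (Fin n)) → α => ∑ r, b (x r) := fun i =>
    Finset.measurable_sum _ fun r _ => hb.comp (measurable_pi_apply r)
  have hN'eq : ∀ i ω, N' i ω = ∑ r : ({i}ᶜ : Finset (Fin n)), b (ξ r ω) := fun i ω =>
    (Finset.sum_coe_sort ({i}ᶜ : Finset (Fin n)) fun r => b (ξ r ω)).symm
  -- on the event `b (ξ i) = 1` the subsample size is `1 + N' i`
  have hgN : ∀ i ω, g (ξ i ω) / N ω = g (ξ i ω) / (1 + N' i ω) := fun i ω => by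
    rcases hb01 (ξ i ω) with h | h
    · simp [hgb _ h]
    · rw [hsplit i ω, h]
  have hbN : ∀ i ω, b (ξ i ω) / N ω = b (ξ i ω) / (1 + N' i ω) := fun i ω => by
    rcases hb01 (ξ i ω) with h | h
    · simp [h]
    · rw [hsplit i ω, h]
  have hbN2 : ∀ i ω, b (ξ i ω) / N ω ^ 2 = b (ξ i ω) / (1 + N' i ω) ^ 2 := fun i ω => by
    rcases hb01 (ξ i ω) with h | h
    · simp [h]
    · rw [hsplit i ω, h]
  have hinv1 : ∀ x : ℝ, 0 ≤ x → (1 + x)⁻¹ ≤ 1 := fun x hx => inv_le_one_of_one_le₀ (by linarith)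
  have hinv0 : ∀ x : ℝ, 0 ≤ x → 0 ≤ (1 + x)⁻¹ := fun x hx => inv_nonneg.mpr (by linarith)
  have hbddint : ∀ f : Ω → ℝ, Measurable f → (∀ ω, 0 ≤ f ω) → (∀ ω, f ω ≤ 1) → Integrable f P := by
    intro f hf h0 h1
    refine Integrable.of_bound hf.aestronglyMeasurable 1 (Filter.Eventually.of_forall fun ω => ?_)
    rw [Real.norm_of_nonneg (h0 ω)]
    exact h1 ω
  have hi' : ∀ i, Integrable (fun ω => (1 + N' i ω)⁻¹) P := fun i =>
    hbddint _ ((hN'm i).const_add 1).inv (fun ω => hinv0 _ (hN'0 i ω)) fun ω => hinv1 _ (hN'0 i ω)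
  have hi : Integrable (fun ω => (1 + N ω)⁻¹) P :=
    hbddint _ (hNm.const_add 1).inv (fun ω => hinv0 _ (hN0 ω)) fun ω => hinv1 _ (hN0 ω)
  have hbint : ∀ i, Integrable (fun ω => b (ξ i ω) / (1 + N' i ω)) P := fun i => by
    refine hbddint _ ((hb.comp (hm i)).div ((hN'm i).const_add 1))
      (fun ω => div_nonneg (hb0 _) (by linarith [hN'0 i ω])) fun ω => ?_
    exact div_le_one_of_le₀ (by linarith [hN'0 i ω, hb1 (ξ i ω)]) (by linarith [hN'0 i ω])
  have hbint2 : ∀ i, Integrable (fun ω => b (ξ i ω) / (1 + N' i ω) ^ 2) P := fun i => by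
    refine hbddint _ ((hb.comp (hm i)).div (((hN'm i).const_add 1).pow_const 2))
      (fun ω => div_nonneg (hb0 _) (by positivity)) fun ω => ?_
    exact div_le_one_of_le₀ (by nlinarith [hN'0 i ω, hb1 (ξ i ω)]) (by positivity)
  -- `n p E[1 / (1 + N)] ≤ 1`, because `p E[1 / (1 + N')] = E[b / N]`
  have hE1 : ∀ i, p * ∫ ω, (1 + N ω)⁻¹ ∂P ≤ ∫ ω, b (ξ i ω) / N ω ∂P := by
    intro i
    have h1 : ∫ ω, b (ξ i ω) / N ω ∂P = p * ∫ ω, (1 + N' i ω)⁻¹ ∂P := by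
      rw [← hEb i]
      simp only [hbN, hN'eq, div_eq_mul_inv]
      exact hind i b (fun x => (1 + ∑ r, b (x r))⁻¹) hb ((hN'F i).const_add 1).inv
    rw [h1]
    refine mul_le_mul_of_nonneg_left (integral_mono hi (hi' i) fun ω => ?_) hp.le
    exact inv_anti₀ (by linarith [hN'0 i ω]) (by linarith [hsplit i ω, hb0 (ξ i ω)])
  have hE2 : n * (p * ∫ ω, (1 + N ω)⁻¹ ∂P) ≤ 1 := by
    have h1 : ∑ i, ∫ ω, b (ξ i ω) / N ω ∂P ≤ 1 := by
      rw [← integral_finsetSum _ fun i _ => by simpa only [hbN] using hbint i]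
      have h2 : ∀ ω, ∑ i, b (ξ i ω) / N ω ≤ 1 := fun ω => by
        rw [← Finset.sum_div]
        exact div_self_le_one _
      calc ∫ ω, ∑ i, b (ξ i ω) / N ω ∂P ≤ ∫ _, (1 : ℝ) ∂P := by
            refine integral_mono (integrable_finsetSum _ fun i _ => ?_) (integrable_const _) h2
            simpa only [hbN] using hbint i
        _ = 1 := by simp
    calc n * (p * ∫ ω, (1 + N ω)⁻¹ ∂P) = ∑ _i : Fin n, p * ∫ ω, (1 + N ω)⁻¹ ∂P := by simp
      _ ≤ _ := Finset.sum_le_sum fun i _ => hE1 i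
      _ ≤ 1 := h1
  -- expansion of the square; the mixed terms vanish
  have hprod : ∀ i l, Integrable (fun ω => g (ξ i ω) / N ω * (g (ξ l ω) / N ω)) P := by
    intro i l
    have h1 := (hg2 i).integrable_mul (hg2 l)
    have h2 := h1.norm
    refine h2.mono' (((hgm i).div hNm).mul ((hgm l).div hNm)).aestronglyMeasurable
      (Filter.Eventually.of_forall fun ω => ?_)
    rw [hgN, hgN, norm_mul, norm_div, norm_div, Pi.mul_apply, norm_mul]
    have h3 : ∀ i, 1 ≤ ‖1 + N' i ω‖ := fun i => by
      rw [Real.norm_of_nonneg (by linarith [hN'0 i ω])]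
      linarith [hN'0 i ω]
    exact mul_le_mul (div_le_self (norm_nonneg _) (h3 i)) (div_le_self (norm_nonneg _) (h3 l))
      (by positivity) (norm_nonneg _)
  have hexp : ∀ ω, ((∑ i, g (ξ i ω)) / N ω) ^ 2
      = ∑ i, ∑ l, g (ξ i ω) / N ω * (g (ξ l ω) / N ω) := fun ω => by
    rw [Finset.sum_div, sq, Finset.sum_mul_sum]
  have hoff : ∀ i l, l ≠ i → ∫ ω, g (ξ i ω) / N ω * (g (ξ l ω) / N ω) ∂P = 0 := by
    intro i l hl
    have hl' : l ∈ ({i}ᶜ : Finset (Fin n)) := by simpa using hl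
    have h1 : ∀ ω, g (ξ i ω) / N ω * (g (ξ l ω) / N ω)
        = g (ξ i ω) * (g (ξ l ω) / (1 + N' i ω) ^ 2) := fun ω => by
      rcases hb01 (ξ i ω) with h | h
      · simp [hgb _ h]
      · rw [hsplit i ω, h, div_mul_div_comm, ← sq, mul_div_assoc]
    simp only [h1, hN'eq]
    have h2 := hind i g (fun x => g (x ⟨l, hl'⟩) / (1 + ∑ r, b (x r)) ^ 2) hg
      ((hg.comp (measurable_pi_apply _)).div (((hN'F i).const_add 1).pow_const 2))
    rw [h2, hEg, zero_mul]
  have hdiag : ∀ i, ∫ ω, g (ξ i ω) / N ω * (g (ξ i ω) / N ω) ∂P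
      = c * ∫ ω, b (ξ i ω) / N ω ^ 2 ∂P := by
    intro i
    have h1 : ∀ ω, g (ξ i ω) / N ω * (g (ξ i ω) / N ω)
        = g (ξ i ω) ^ 2 * ((1 + N' i ω) ^ 2)⁻¹ := fun ω => by
      rw [hgN, div_mul_div_comm, ← sq, ← sq, div_eq_mul_inv]
    have hF : Measurable fun x : ({i}ᶜ : Finset (Fin n)) → α => ((1 + ∑ r, b (x r)) ^ 2)⁻¹ :=
      (((hN'F i).const_add 1).pow_const 2).inv
    have h2 := hind i (fun z => g z ^ 2) _ (hg.pow_const 2) hF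
    have h3 := hind i b _ hb hF
    simp only [h1, hbN2, hN'eq]
    simp only [div_eq_mul_inv]
    rw [h2, h3, hEg2, hEb]
    ring
  have hint : Integrable (fun ω => ((∑ i, g (ξ i ω)) / N ω) ^ 2) P := by
    simp only [hexp]
    exact integrable_finsetSum _ fun i _ => integrable_finsetSum _ fun l _ => hprod i l
  refine ⟨hint, ?_⟩
  have hsum : ∫ ω, ((∑ i, g (ξ i ω)) / N ω) ^ 2 ∂P = c * ∑ i, ∫ ω, b (ξ i ω) / N ω ^ 2 ∂P := by
    simp only [hexp]
    rw [integral_finsetSum _ fun i _ => integrable_finsetSum _ fun l _ => hprod i l,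
      Finset.mul_sum]
    refine Finset.sum_congr rfl fun i _ => ?_
    rw [integral_finsetSum _ fun l _ => hprod i l, Finset.sum_eq_single i
      (fun l _ hl => hoff i l hl) (by simp), hdiag]
  have hlast : ∑ i, ∫ ω, b (ξ i ω) / N ω ^ 2 ∂P ≤ 2 * ∫ ω, (1 + N ω)⁻¹ ∂P := by
    rw [← integral_finsetSum _ fun i _ => by simpa only [hbN2] using hbint2 i,
      ← integral_const_mul]
    refine integral_mono (integrable_finsetSum _ fun i _ => by
      simpa only [hbN2] using hbint2 i) (hi.const_mul 2) fun ω => ?_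
    -- pointwise this is `1 / N ≤ 2 / (1 + N)` for `N ≥ 1`, and `0 ≤ 2` for `N = 0`
    change ∑ i, b (ξ i ω) / N ω ^ 2 ≤ 2 * (1 + N ω)⁻¹
    rw [← Finset.sum_div]
    change N ω / N ω ^ 2 ≤ 2 * (1 + N ω)⁻¹
    by_cases h : ∃ i, b (ξ i ω) = 1
    · obtain ⟨i, hi1⟩ := h
      have hN1 : 1 ≤ N ω := by linarith [hsplit i ω, hN'0 i ω]
      rw [← div_eq_mul_inv, div_le_div_iff₀ (by positivity) (by positivity)]
      nlinarith
    · have : N ω = 0 := Finset.sum_eq_zero fun i _ =>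
        (hb01 (ξ i ω)).resolve_right fun h1 => h ⟨i, h1⟩
      simp [this]
  rw [hsum]
  have hnp : 0 < (n : ℝ) * p := by positivity
  have h5 : ∫ ω, (1 + N ω)⁻¹ ∂P ≤ 1 / (n * p) := by
    rw [le_div_iff₀ hnp]
    linarith
  calc c * ∑ i, ∫ ω, b (ξ i ω) / N ω ^ 2 ∂P ≤ c * (2 * (1 / (n * p))) :=
        mul_le_mul_of_nonneg_left (hlast.trans (by linarith)) hc
    _ = 2 * c / (n * p) := by ring

/-! ### Measurability of the plug-in classifier -/

section Measurability

variable {d n : ℕ}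

theorem measurableSet_units_singleton (k : ℤˣ) : MeasurableSet ({k} : Set ℤˣ) := by
  refine ⟨{(k : ℤ)}, measurableSet_singleton _, ?_⟩
  ext x
  simp [Units.ext_iff]

theorem measurableSet_units (s : Set ℤˣ) : MeasurableSet s := by
  rw [← Set.biUnion_of_singleton s]
  exact MeasurableSet.biUnion s.to_countable fun k _ => measurableSet_units_singleton k

theorem measurable_of_fibers {β : Type*} [MeasurableSpace β] {f : MaskedObs d → β}
    (h : ∀ m, Measurable fun y : Obs m → ℝ => f ⟨m, y⟩) : Measurable f :=
  fun _ hs => MeasurableSpace.measurableSet_iInf.mpr fun m => h m hs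

theorem measurable_maskedObs_mk (m : Pattern d) :
    Measurable fun y : Obs m → ℝ => (⟨m, y⟩ : MaskedObs d) :=
  fun _ hs => MeasurableSpace.measurableSet_iInf.mp hs m

theorem measurable_pattern : Measurable fun z : MaskedObs d => z.1 :=
  measurable_of_fibers fun _ => measurable_const

theorem measurable_zeroExtend : Measurable fun z : MaskedObs d => zeroExtend z.1 z.2 := by
  refine measurable_of_fibers fun m => measurable_pi_lambda _ fun j => ?_
  by_cases h : m j = false
  · simp only [zeroExtend, h, dite_true]
    exact measurable_pi_apply (⟨j, h⟩ : Obs m)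
  · simp only [zeroExtend, h]
    exact measurable_const

theorem measurable_sgn : Measurable sgn :=
  Measurable.ite (measurableSet_Ici (a := (0 : ℝ))) measurable_const measurable_const

/-- The indicator that a labelled observation has class `k` and shows its `j`-th coordinate. -/
def seen (k : ℤˣ) (j : Fin d) (z : MaskedObs d × ℤˣ) : ℝ :=
  if z.2 = k ∧ z.1.1 j = false then 1 else 0

theorem measurableSet_seen (k : ℤˣ) (j : Fin d) :
    MeasurableSet {z : MaskedObs d × ℤˣ | z.2 = k ∧ z.1.1 j = false} := by
  refine MeasurableSet.inter (measurable_snd (measurableSet_units_singleton k)) ?_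
  have h : Measurable fun z : MaskedObs d × ℤˣ => z.1.1 j :=
    (measurable_pi_apply j).comp (measurable_pattern.comp measurable_fst)
  exact h (measurableSet_singleton false)

theorem measurable_seen (k : ℤˣ) (j : Fin d) : Measurable (seen k j) :=
  Measurable.ite (measurableSet_seen k j) measurable_const measurable_const

theorem measurable_zeroExtend_apply (j : Fin d) :
    Measurable fun z : MaskedObs d × ℤˣ => zeroExtend z.1.1 z.1.2 j :=
  (measurable_pi_apply j).comp (measurable_zeroExtend.comp measurable_fst)

theorem muHat_eq (D : Fin n → MaskedObs d × ℤˣ) (k : ℤˣ) (j : Fin d) :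
    muHat D k j = (∑ i, seen k j (D i) * zeroExtend (D i).1.1 (D i).1.2 j)
      / ∑ i, seen k j (D i) := by
  rw [muHat]
  congr 1
  · refine Finset.sum_congr rfl fun i _ => ?_
    by_cases h : (D i).2 = k ∧ (D i).1.1 j = false
    · simp [seen, h, zeroExtend]
    · rw [dif_neg h, seen, if_neg h, zero_mul]
  · simp [countObs, seen]

theorem measurable_muHat (k : ℤˣ) :
    Measurable fun D : Fin n → MaskedObs d × ℤˣ => muHat D k := by
  refine measurable_pi_lambda _ fun j => ?_
  simp only [muHat_eq]
  refine Measurable.div (Finset.measurable_sum _ fun i _ => ?_)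
    (Finset.measurable_sum _ fun i _ => (measurable_seen k j).comp (measurable_pi_apply i))
  exact ((measurable_seen k j).comp (measurable_pi_apply i)).mul
    ((measurable_zeroExtend_apply j).comp (measurable_pi_apply i))

theorem ldaRule_eq (S : Matrix (Fin d) (Fin d) ℝ) (ν : ℤˣ → Fin d → ℝ) (z : MaskedObs d) :
    ldaRule S ν z
      = sgn (ldaScore (subcov z.1 S) (subvec z.1 (ν 1)) (subvec z.1 (ν (-1))) z.2) := rfl

theorem measurable_plugIn (S : Matrix (Fin d) (Fin d) ℝ) :
    Measurable fun q : (Fin n → MaskedObs d × ℤˣ) × MaskedObs d => plugIn S q.1 q.2 := by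
  let F : ((Fin d → ℝ) × (Fin d → ℝ) × (Fin d → ℝ)) × Pattern d → ℝ := fun p =>
    ldaScore (subcov p.2 S) (subvec p.2 p.1.1) (subvec p.2 p.1.2.1) (subvec p.2 p.1.2.2)
  have hF : Measurable F := by
    refine measurable_from_prod_countable_left fun m => ?_
    change Measurable fun x : (Fin d → ℝ) × (Fin d → ℝ) × (Fin d → ℝ) =>
      ldaScore (subcov m S) (subvec m x.1) (subvec m x.2.1) (subvec m x.2.2)
    simp only [ldaScore, dotProduct, Matrix.mulVec, subvec, Pi.sub_apply, Pi.add_apply,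
      Pi.smul_apply, smul_eq_mul]
    fun_prop
  have h : (fun q : (Fin n → MaskedObs d × ℤˣ) × MaskedObs d => plugIn S q.1 q.2)
      = fun q => sgn (F ((muHat q.1 1, muHat q.1 (-1), zeroExtend q.2.1 q.2.2), q.2.1)) := by
    funext q
    simp only [F, subvec_zeroExtend]
    rfl
  rw [h]
  refine measurable_sgn.comp (hF.comp (Measurable.prodMk (Measurable.prodMk ?_
    (Measurable.prodMk ?_ ?_)) (measurable_pattern.comp measurable_snd)))
  · exact (measurable_muHat 1).comp measurable_fst
  · exact (measurable_muHat (-1)).comp measurable_fst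
  · exact measurable_zeroExtend.comp measurable_snd

theorem measurable_ldaRule (S : Matrix (Fin d) (Fin d) ℝ) (hS : S.PosDef)
    (ν : ℤˣ → Fin d → ℝ) : Measurable (ldaRule S ν) :=
  measurable_of_fibers fun m => measurable_sgn.comp
    (measurable_ldaScore (posDef_subcov (m := m) hS) (subvec m (ν 1)) (subvec m (ν (-1))))

end Measurability

/-! ### The misclassification probability in the model -/

section Risk

variable {Ω : Type*} [MeasurableSpace Ω] {d : ℕ} {P : Measure Ω} [IsProbabilityMeasure P]
  {X : Ω → EuclideanSpace ℝ (Fin d)} {M : Ω → Pattern d} {Y : Ω → ℤˣ}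
  {μ : ℤˣ → EuclideanSpace ℝ (Fin d)} {S : Matrix (Fin d) (Fin d) ℝ} {η : ℝ}

theorem measurableSet_class (hY : Measurable Y) (k : ℤˣ) : MeasurableSet {ω | Y ω = k} :=
  hY (measurableSet_units_singleton k)

theorem IsBalancedLDA.measureReal_class (hL : IsBalancedLDA P μ S X Y) (hY : Measurable Y)
    (k : ℤˣ) : P.real {ω | Y ω = k} = 1 / 2 := by
  have h1 : P.real {ω | Y ω = 1} = P.real {ω | Y ω = -1} := by simp only [measureReal_def, hL.1]
  have h2 : {ω | Y ω = -1} = {ω | Y ω = 1}ᶜ := by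
    ext ω
    rcases Int.units_eq_one_or (Y ω) with h | h <;> simp [h]
  have h3 : P.real {ω | Y ω = -1} = 1 - P.real {ω | Y ω = 1} := by
    rw [h2, measureReal_compl (measurableSet_class hY 1), probReal_univ]
  rcases Int.units_eq_one_or k with rfl | rfl <;> linarith

theorem IsBalancedLDA.measureReal_inter (hL : IsBalancedLDA P μ S X Y) (hX : Measurable X)
    (hY : Measurable Y) (k : ℤˣ) {A : Set (EuclideanSpace ℝ (Fin d))} (hA : MeasurableSet A) :
    P.real ({ω | Y ω = k} ∩ X ⁻¹' A) = (multivariateGaussian (μ k) S).real A / 2 := by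
  have h1 := (hL.2 k).map_eq
  rw [← h1, map_measureReal_apply hX hA, measureReal_def (cond _ _),
    cond_apply (measurableSet_class hY k), ENNReal.toReal_mul, ENNReal.toReal_inv,
    ← measureReal_def, ← measureReal_def, hL.measureReal_class hY]
  ring

/-- The law of the observed subvector in class `k` under the pattern `m`. -/
def obsLaw (μ : ℤˣ → EuclideanSpace ℝ (Fin d)) (S : Matrix (Fin d) (Fin d) ℝ) (k : ℤˣ)
    (m : Pattern d) : Measure (Obs m → ℝ) :=
  (multivariateGaussian (μ k) S).map (fun x : EuclideanSpace ℝ (Fin d) => subvec m x)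

instance (k : ℤˣ) (m : Pattern d) : IsProbabilityMeasure (obsLaw μ S k m) :=
  Measure.isProbabilityMeasure_map measurable_subvec.aemeasurable

/-- The risk of a classifier is a mixture over the patterns of its balanced errors on the observed
subvectors. -/
theorem risk_eq_sum (hX : Measurable X) (hM : Measurable M) (hY : Measurable Y)
    (hI : IsMCAR P X M Y) (hL : IsBalancedLDA P μ S X Y) {h : MaskedObs d → ℤˣ}
    (hh : Measurable h) :
    P.real {ω | Y ω ≠ h (observe X M ω)} = ∑ m, P.real (M ⁻¹' {m}) *
      (((obsLaw μ S 1 m).real {y | h ⟨m, y⟩ ≠ 1}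
        + (obsLaw μ S (-1) m).real {y | h ⟨m, y⟩ ≠ -1}) / 2) := by
  have hset : ∀ m k, MeasurableSet {y : Obs m → ℝ | h ⟨m, y⟩ ≠ k} := fun m k =>
    (hh.comp (measurable_maskedObs_mk m)) (measurableSet_units {l | l ≠ k})
  have hpre : ∀ m k, MeasurableSet
      ((fun x : EuclideanSpace ℝ (Fin d) => subvec m x) ⁻¹' {y : Obs m → ℝ | h ⟨m, y⟩ ≠ k}) :=
    fun m k => measurable_subvec (hset m k)
  set B : Pattern d → Set (EuclideanSpace ℝ (Fin d) × ℤˣ) :=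
    fun m => {q | q.2 ≠ h ⟨m, subvec m q.1⟩} with hB
  have hBk : ∀ m, (fun ω => (X ω, Y ω)) ⁻¹' (B m)
      = ({ω | Y ω = 1} ∩ X ⁻¹' ((fun x : EuclideanSpace ℝ (Fin d) => subvec m x) ⁻¹'
          {y : Obs m → ℝ | h ⟨m, y⟩ ≠ 1}))
        ∪ ({ω | Y ω = -1} ∩ X ⁻¹' ((fun x : EuclideanSpace ℝ (Fin d) => subvec m x) ⁻¹'
          {y : Obs m → ℝ | h ⟨m, y⟩ ≠ -1})) := by
    intro m
    ext ω
    rcases Int.units_eq_one_or (Y ω) with hy | hy <;> simp [hB, hy, eq_comm]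
  have hBm : ∀ m, MeasurableSet (B m) := by
    intro m
    have h1 : Measurable fun q : EuclideanSpace ℝ (Fin d) × ℤˣ => h ⟨m, subvec m q.1⟩ :=
      hh.comp ((measurable_maskedObs_mk m).comp (measurable_subvec.comp measurable_fst))
    have h2 : B m = ⋃ k : ℤˣ, {q | q.2 = k} ∩ {q | h ⟨m, subvec m q.1⟩ ≠ k} := by
      ext q
      simp [hB, eq_comm]
    rw [h2]
    exact MeasurableSet.iUnion fun k => (measurable_snd (measurableSet_units_singleton k)).inter
      (h1 (measurableSet_units {l | l ≠ k}))
  have hunion : {ω | Y ω ≠ h (observe X M ω)}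
      = ⋃ m ∈ (Finset.univ : Finset (Pattern d)), M ⁻¹' {m} ∩ (fun ω => (X ω, Y ω)) ⁻¹' (B m) := by
    ext ω
    simp [hB, observe]
  rw [hunion, measureReal_biUnion_finset]
  · refine Finset.sum_congr rfl fun m _ => ?_
    have hind := hI.measure_inter_preimage_eq_mul _ _ (measurableSet_singleton m) (hBm m)
    rw [measureReal_def, hind, ENNReal.toReal_mul, ← measureReal_def, ← measureReal_def, hBk,
      measureReal_union]
    · rw [hL.measureReal_inter hX hY 1 (hpre m 1), hL.measureReal_inter hX hY (-1) (hpre m (-1)),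
        obsLaw, obsLaw, map_measureReal_apply measurable_subvec (hset m 1),
        map_measureReal_apply measurable_subvec (hset m (-1))]
      ring
    · rw [Set.disjoint_left]
      rintro ω ⟨h1, -⟩ ⟨h2, -⟩
      have h3 : (1 : ℤˣ) = -1 := h1.symm.trans h2
      exact absurd h3 (by decide)
    · exact (measurableSet_class hY (-1)).inter (hX (hpre m (-1)))
  · intro m _ m' _ hmm
    refine Set.disjoint_left.mpr ?_
    rintro ω ⟨h1, -⟩ ⟨h2, -⟩
    exact hmm (h1.symm.trans h2)
  · intro m _
    exact (hM (measurableSet_singleton m)).inter ((hX.prodMk hY) (hBm m))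

theorem sgn_ne_one_iff {t : ℝ} : sgn t ≠ 1 ↔ t < 0 := by
  rw [sgn]
  split_ifs with h
  · simp [h]
  · simpa using h

theorem sgn_ne_neg_one_iff {t : ℝ} : sgn t ≠ -1 ↔ 0 ≤ t := by
  rw [sgn]
  split_ifs with h
  · simpa using h
  · simpa using h

/-- The mixture over the patterns of the errors of the discriminant rules with class means `ν`. -/
def ldaRisk (P : Measure Ω) (M : Ω → Pattern d) (μ : ℤˣ → EuclideanSpace ℝ (Fin d))
    (S : Matrix (Fin d) (Fin d) ℝ) (ν : ℤˣ → Fin d → ℝ) : ℝ :=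
  ∑ m, P.real (M ⁻¹' {m}) * ldaError (obsLaw μ S 1 m) (obsLaw μ S (-1) m) (subcov m S)
    (subvec m (ν 1)) (subvec m (ν (-1)))

theorem risk_ldaRule (hX : Measurable X) (hM : Measurable M) (hY : Measurable Y)
    (hI : IsMCAR P X M Y) (hL : IsBalancedLDA P μ S X Y) (hS : S.PosDef) (ν : ℤˣ → Fin d → ℝ) :
    P.real {ω | Y ω ≠ ldaRule S ν (observe X M ω)} = ldaRisk P M μ S ν := by
  rw [risk_eq_sum hX hM hY hI hL (measurable_ldaRule S hS ν)]
  simp only [ldaRule_eq, sgn_ne_one_iff, sgn_ne_neg_one_iff]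
  rfl

/-- The Bayes risk is at least that of the discriminant rules with the true means. -/
theorem ldaRisk_le_bayesMissRisk (hX : Measurable X) (hM : Measurable M) (hY : Measurable Y)
    (hI : IsMCAR P X M Y) (hL : IsBalancedLDA P μ S X Y) (hS : S.PosDef) :
    ldaRisk P M μ S (fun k => μ k) ≤ bayesMissRisk P X M Y := by
  obtain ⟨f, hf, hfe⟩ := (stronglyMeasurable_condExp (μ := P)
    (m := MeasurableSpace.comap (observe X M) inferInstance)
    (f := fun ω' => ((Y ω' : ℤ) : ℝ))).measurable.exists_eq_measurable_comp
  have h1 : bayesMissRisk P X M Y = P.real {ω | Y ω ≠ (sgn ∘ f) (observe X M ω)} := by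
    simp only [bayesMissRisk, bayesPredictor, hfe, Function.comp]
  have hm : Measurable (sgn ∘ f) := measurable_sgn.comp hf
  rw [h1, risk_eq_sum hX hM hY hI hL hm]
  refine Finset.sum_le_sum fun m _ => mul_le_mul_of_nonneg_left ?_ measureReal_nonneg
  have hU : MeasurableSet {y : Obs m → ℝ | (sgn ∘ f) ⟨m, y⟩ ≠ -1} :=
    (hm.comp (measurable_maskedObs_mk m)) (measurableSet_units {l | l ≠ -1})
  have h2 := ldaError_le_of_isGaussianVector (posDef_subcov (m := m) hS)
    (isGaussianVector_map_subvec hS (μ 1)) (isGaussianVector_map_subvec hS (μ (-1))) hU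
    (Q₁ := obsLaw μ S 1 m) (Q₂ := obsLaw μ S (-1) m)
  have h3 : {y : Obs m → ℝ | (sgn ∘ f) ⟨m, y⟩ ≠ -1}ᶜ = {y | (sgn ∘ f) ⟨m, y⟩ ≠ 1} := by
    ext y
    rcases Int.units_eq_one_or ((sgn ∘ f) ⟨m, y⟩) with h | h <;>
      simp only [Set.mem_compl_iff, Set.mem_ofPred_eq, h] <;> decide
  rwa [h3] at h2

theorem IsBernoulliMissing.mem_Icc (hd : 0 < d) (hB : IsBernoulliMissing P η M) :
    0 ≤ η ∧ η ≤ 1 := by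
  rw [← hB.2 ⟨0, hd⟩]
  exact ⟨measureReal_nonneg, measureReal_le_one⟩

theorem measureReal_observed (hM : Measurable M) (hB : IsBernoulliMissing P η M) (j : Fin d) :
    P.real {ω | M ω j = false} = 1 - η := by
  have h : {ω | M ω j = false} = {ω | M ω j = true}ᶜ := by ext ω; simp
  have hm : MeasurableSet {ω | M ω j = true} :=
    ((measurable_pi_apply j).comp hM) (measurableSet_singleton true)
  rw [h, measureReal_compl hm, probReal_univ, hB.2 j]

theorem sum_pattern_indicator (hM : Measurable M) (hB : IsBernoulliMissing P η M) (j : Fin d) :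
    ∑ m, P.real (M ⁻¹' {m}) * (if m j = false then 1 else 0) = 1 - η := by
  rw [← measureReal_observed hM hB j]
  have h : {ω | M ω j = false}
      = ⋃ m ∈ Finset.univ.filter (fun m : Pattern d => m j = false), M ⁻¹' {m} := by
    ext ω; simp
  rw [h, measureReal_biUnion_finset]
  · simp [Finset.sum_filter]
  · intro m _ m' _ hmm
    refine Set.disjoint_left.mpr ?_
    intro ω h1 h2
    exact hmm (h1.symm.trans h2)
  · exact fun m _ => hM (measurableSet_singleton m)

theorem sum_pattern_subvec_sq (hM : Measurable M) (hB : IsBernoulliMissing P η M)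
    (v : Fin d → ℝ) :
    ∑ m, P.real (M ⁻¹' {m}) * (subvec m v ⬝ᵥ subvec m v) = (1 - η) * ∑ j, v j ^ 2 := by
  have h : ∀ m : Pattern d, subvec m v ⬝ᵥ subvec m v
      = ∑ j, (if m j = false then 1 else 0) * v j ^ 2 := by
    intro m
    rw [← zeroExtend_dotProduct]
    refine Finset.sum_congr rfl fun j _ => ?_
    by_cases hj : m j = false <;> simp [zeroExtend, subvec, hj, sq]
  simp only [h, Finset.mul_sum]
  rw [Finset.sum_comm]
  refine Finset.sum_congr rfl fun j _ => ?_
  rw [← sum_pattern_indicator hM hB j, Finset.sum_mul]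
  exact Finset.sum_congr rfl fun m _ => by ring

theorem sum_measureReal_pattern (hM : Measurable M) : ∑ m, P.real (M ⁻¹' {m}) = 1 := by
  rw [← probReal_univ (μ := P)]
  have h : (Set.univ : Set Ω) = ⋃ m ∈ (Finset.univ : Finset (Pattern d)), M ⁻¹' {m} := by
    ext ω; simp
  rw [h, measureReal_biUnion_finset]
  · intro m _ m' _ hmm
    refine Set.disjoint_left.mpr ?_
    intro ω h1 h2
    exact hmm (h1.symm.trans h2)
  · exact fun m _ => hM (measurableSet_singleton m)

/-- The excess risk of the discriminant rules with means `ν`, linearised in the squared estimation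
error by `√a ≤ a / (2t) + t / 2`. -/
theorem ldaRisk_sub_le (hd : 0 < d) (hM : Measurable M) (hB : IsBernoulliMissing P η M)
    (hS : S.PosDef) (ν : ℤˣ → Fin d → ℝ) {t : ℝ} (ht : 0 < t) :
    ldaRisk P M μ S ν - ldaRisk P M μ S (fun k => μ k)
      ≤ (((1 - η) * ∑ j, (μ 1 j - ν 1 j) ^ 2 + (1 - η) * ∑ j, (μ (-1) j - ν (-1) j) ^ 2)
          / (2 * t * lambdaMin S) + t) / Real.sqrt (2 * Real.pi) := by
  have hl := lambdaMin_pos hd hS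
  have hpi : 0 < Real.sqrt (2 * Real.pi) := by positivity
  have hlin : ∀ (m : Pattern d) (k : ℤˣ),
      whitenedNorm (subcov m S) (subvec m (μ k) - subvec m (ν k))
        ≤ (subvec m (fun j => μ k j - ν k j) ⬝ᵥ subvec m (fun j => μ k j - ν k j))
            / (2 * t * lambdaMin S) + t / 2 := by
    intro m k
    have h1 := whitenedNorm_sq_le (m := m) hd hS (subvec m (μ k) - subvec m (ν k))
    have h2 : subvec m (fun j => μ k j - ν k j) = subvec m (μ k) - subvec m (ν k) := rfl
    rw [h2]
    set w := whitenedNorm (subcov m S) (subvec m (μ k) - subvec m (ν k))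
    set q := (subvec m (μ k) - subvec m (ν k)) ⬝ᵥ (subvec m (μ k) - subvec m (ν k))
    have h3 : q / (2 * t * lambdaMin S) = q / lambdaMin S / (2 * t) := by
      rw [div_div, mul_comm]
    rw [h3]
    have h4 : w ^ 2 / (2 * t) ≤ q / lambdaMin S / (2 * t) := by gcongr
    have h5 : w ≤ w ^ 2 / (2 * t) + t / 2 := by
      rw [div_add_div _ _ (by positivity) two_ne_zero, le_div_iff₀ (by positivity)]
      nlinarith [sq_nonneg (w - t)]
    linarith
  have h1 := sum_pattern_subvec_sq hM hB (fun j => μ 1 j - ν 1 j)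
  have h2 := sum_pattern_subvec_sq hM hB (fun j => μ (-1) j - ν (-1) j)
  have h3 := sum_measureReal_pattern (P := P) hM
  rw [ldaRisk, ldaRisk, ← Finset.sum_sub_distrib]
  calc _ ≤ ∑ m, P.real (M ⁻¹' {m}) *
        (((subvec m (fun j => μ 1 j - ν 1 j) ⬝ᵥ subvec m (fun j => μ 1 j - ν 1 j)
          + subvec m (fun j => μ (-1) j - ν (-1) j) ⬝ᵥ subvec m (fun j => μ (-1) j - ν (-1) j))
            / (2 * t * lambdaMin S) + t) / Real.sqrt (2 * Real.pi)) := by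
        refine Finset.sum_le_sum fun m _ => ?_
        rw [← mul_sub]
        refine mul_le_mul_of_nonneg_left ?_ measureReal_nonneg
        refine (ldaError_sub_le (posDef_subcov (m := m) hS)
          (isGaussianVector_map_subvec hS (μ 1)) (isGaussianVector_map_subvec hS (μ (-1)))
          (subvec m (ν 1)) (subvec m (ν (-1)))
          (Q₁ := obsLaw μ S 1 m) (Q₂ := obsLaw μ S (-1) m)).trans ?_
        refine div_le_div_of_nonneg_right ?_ hpi.le
        have := hlin m 1
        have := hlin m (-1)
        rw [add_div]
        linarith
    _ = _ := by
        rw [← h1, ← h2, ← Finset.sum_add_distrib]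
        have h4 : t = ∑ m, t * P.real (M ⁻¹' {m}) := by rw [← Finset.mul_sum, h3, mul_one]
        conv_rhs => enter [1, 2]; rw [h4]
        rw [Finset.sum_div, ← Finset.sum_add_distrib, Finset.sum_div]
        exact Finset.sum_congr rfl fun m _ => by ring

end Risk

/-! ### Mean squared error of the class means -/

section MeanSquaredError

variable {Ω : Type*} [MeasurableSpace Ω] {d n : ℕ} {P : Measure Ω} [IsProbabilityMeasure P]
  {X : Ω → EuclideanSpace ℝ (Fin d)} {M : Ω → Pattern d} {Y : Ω → ℤˣ}
  {μ : ℤˣ → EuclideanSpace ℝ (Fin d)} {S : Matrix (Fin d) (Fin d) ℝ} {η : ℝ}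

/-- The law of the labelled observation `(Z, Y)`. -/
def obsLabelLaw (P : Measure Ω) (X : Ω → EuclideanSpace ℝ (Fin d)) (M : Ω → Pattern d)
    (Y : Ω → ℤˣ) : Measure (MaskedObs d × ℤˣ) :=
  P.map fun ω => (observe X M ω, Y ω)

theorem measurable_obsLabel (hX : Measurable X) (hM : Measurable M) (hY : Measurable Y) :
    Measurable fun ω => (observe X M ω, Y ω) :=
  (measurable_observe hX hM).prodMk hY

/-- The centred observation `X_j - a` on the event that `Y = k` and `X_j` is observed, and `0`
elsewhere. -/
def centred (k : ℤˣ) (j : Fin d) (a : ℝ) (z : MaskedObs d × ℤˣ) : ℝ :=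
  seen k j z * (zeroExtend z.1.1 z.1.2 j - a)

theorem measurable_centred (k : ℤˣ) (j : Fin d) (a : ℝ) : Measurable (centred k j a) :=
  (measurable_seen k j).mul ((measurable_zeroExtend_apply j).sub_const a)

theorem seen_eq_zero_or_one (k : ℤˣ) (j : Fin d) (z : MaskedObs d × ℤˣ) :
    seen k j z = 0 ∨ seen k j z = 1 := by
  rw [seen]
  split_ifs <;> simp

/-- The indicator that the `j`-th coordinate is observed. -/
def obsInd (j : Fin d) (m : Pattern d) : ℝ := if m j = false then 1 else 0

/-- The deviation of `X_j` from `a` within the class `k`. -/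
def classDev (k : ℤˣ) (j : Fin d) (a : ℝ) (q : EuclideanSpace ℝ (Fin d) × ℤˣ) : ℝ :=
  if q.2 = k then q.1 j - a else 0

theorem measurableSet_observed (j : Fin d) : MeasurableSet {m : Pattern d | m j = false} :=
  (measurable_pi_apply (X := fun _ : Fin d => Bool) j) (measurableSet_singleton false)

theorem measurable_obsInd (j : Fin d) : Measurable (obsInd j) :=
  Measurable.ite (measurableSet_observed j) measurable_const measurable_const

theorem measurable_classDev (k : ℤˣ) (j : Fin d) (a : ℝ) : Measurable (classDev k j a) :=
  Measurable.ite (measurable_snd (measurableSet_units_singleton k)) (by fun_prop) measurable_const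

omit [MeasurableSpace Ω] in
theorem centred_observe (k : ℤˣ) (j : Fin d) (a : ℝ) (ω : Ω) :
    centred k j a (observe X M ω, Y ω) = obsInd j (M ω) * classDev k j a (X ω, Y ω) := by
  by_cases h1 : Y ω = k <;> by_cases h2 : M ω j = false <;>
    simp [centred, seen, observe, obsInd, classDev, zeroExtend, subvec, h1, h2]

theorem integral_obsInd (hM : Measurable M) (hB : IsBernoulliMissing P η M) (j : Fin d) :
    ∫ ω, obsInd j (M ω) ∂P = 1 - η := by
  have hm : MeasurableSet {ω | M ω j = false} := hM (measurableSet_observed j)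
  rw [← measureReal_observed hM hB j, ← integral_indicator_one hm]
  congr 1 with ω
  simp [obsInd, Set.indicator_apply]

theorem restrict_class_eq (hL : IsBalancedLDA P μ S X Y) (hY : Measurable Y) (k : ℤˣ) :
    P.restrict {ω | Y ω = k} = (2⁻¹ : ENNReal) • ProbabilityTheory.cond P {ω | Y ω = k} := by
  have h : P {ω | Y ω = k} = 2⁻¹ := by
    have := hL.measureReal_class hY k
    rw [measureReal_def] at this
    rw [← ENNReal.ofReal_toReal (measure_ne_top P _), this, one_div,
      ENNReal.ofReal_inv_of_pos two_pos]
    simp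
  rw [ProbabilityTheory.cond, h, inv_inv, smul_smul,
    ENNReal.inv_mul_cancel two_ne_zero ENNReal.ofNat_ne_top, one_smul]

theorem integral_class (hL : IsBalancedLDA P μ S X Y) (hY : Measurable Y)
    (k : ℤˣ) {f : EuclideanSpace ℝ (Fin d) → ℝ} (hf : Measurable f) :
    ∫ ω in {ω | Y ω = k}, f (X ω) ∂P = (∫ x, f x ∂multivariateGaussian (μ k) S) / 2 := by
  rw [restrict_class_eq hL hY, integral_smul_measure]
  have := (hL.2 k).integral_comp (f := f) hf.aestronglyMeasurable
  simp only [Function.comp_def] at this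
  rw [this]
  simp
  ring

theorem integrable_class (hL : IsBalancedLDA P μ S X Y) (hX : Measurable X) (hY : Measurable Y)
    (k : ℤˣ) {f : EuclideanSpace ℝ (Fin d) → ℝ}
    (hf : Integrable f (multivariateGaussian (μ k) S)) :
    IntegrableOn (fun ω => f (X ω)) {ω | Y ω = k} P := by
  rw [IntegrableOn, restrict_class_eq hL hY]
  refine Integrable.smul_measure ?_ (by simp)
  rw [← (hL.2 k).map_eq] at hf
  exact hf.comp_measurable hX

omit [MeasurableSpace Ω] in
theorem classDev_eq_indicator (k : ℤˣ) (j : Fin d) (a : ℝ) :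
    (fun ω => classDev k j a (X ω, Y ω))
      = {ω | Y ω = k}.indicator (fun ω => (X ω) j - a) := by
  funext ω
  simp [classDev, Set.indicator_apply]

omit [MeasurableSpace Ω] in
theorem classDev_sq_eq_indicator (k : ℤˣ) (j : Fin d) (a : ℝ) :
    (fun ω => classDev k j a (X ω, Y ω) ^ 2)
      = {ω | Y ω = k}.indicator (fun ω => ((X ω) j - a) ^ 2) := by
  funext ω
  simp only [classDev, Set.indicator_apply, Set.mem_ofPred_eq]
  split_ifs <;> simp

theorem memLp_eval_sub (ν : EuclideanSpace ℝ (Fin d)) (j : Fin d) (a : ℝ) :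
    MemLp (fun x : EuclideanSpace ℝ (Fin d) => x j - a) 2 (multivariateGaussian ν S) := by
  have h : MemLp (fun x : EuclideanSpace ℝ (Fin d) => x j) 2 (multivariateGaussian ν S) :=
    (IsGaussian.memLp_two_id (μ := multivariateGaussian ν S)).continuousLinearMap_comp
      (EuclideanSpace.proj (𝕜 := ℝ) j)
  exact h.sub (memLp_const a)

theorem integral_eval (ν : EuclideanSpace ℝ (Fin d)) (j : Fin d) :
    ∫ x, x j ∂multivariateGaussian ν S = ν j := by
  have h := (EuclideanSpace.proj (𝕜 := ℝ) j).integral_comp_id_comm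
    (IsGaussian.integrable_id (μ := multivariateGaussian ν S))
  rw [integral_id_multivariateGaussian] at h
  exact h

theorem integral_eval_sub_sq (hS : S.PosDef) (ν : EuclideanSpace ℝ (Fin d)) (j : Fin d) :
    ∫ x, (x j - ν j) ^ 2 ∂multivariateGaussian ν S = S j j := by
  rw [← variance_eval_multivariateGaussian (μ := ν) hS.posSemidef j,
    variance_eq_integral (by fun_prop), integral_eval]

omit [IsProbabilityMeasure P] in
theorem indepFun_obsInd_classDev (hI : IsMCAR P X M Y) (k : ℤˣ) (j : Fin d) (a : ℝ) :
    IndepFun (fun ω => obsInd j (M ω)) (fun ω => classDev k j a (X ω, Y ω)) P :=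
  hI.comp (measurable_obsInd j) (measurable_classDev k j a)

theorem integral_centred (hX : Measurable X) (hM : Measurable M) (hY : Measurable Y)
    (hI : IsMCAR P X M Y) (hL : IsBalancedLDA P μ S X Y) (k : ℤˣ) (j : Fin d) :
    ∫ z, centred k j (μ k j) z ∂obsLabelLaw P X M Y = 0 := by
  rw [obsLabelLaw, integral_map (measurable_obsLabel hX hM hY).aemeasurable
    (measurable_centred _ _ _).aestronglyMeasurable]
  simp only [centred_observe]
  rw [(indepFun_obsInd_classDev hI k j (μ k j)).integral_fun_mul_eq_mul_integral
    ((measurable_obsInd j).comp hM).aestronglyMeasurable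
    ((measurable_classDev k j _).comp (hX.prodMk hY)).aestronglyMeasurable,
    classDev_eq_indicator, integral_indicator (measurableSet_class hY k),
    integral_class hL hY k (f := fun x => x j - μ k j) (by fun_prop),
    integral_sub (by simpa using (memLp_eval_sub (μ k) j 0).integrable one_le_two)
      (integrable_const _), integral_eval]
  simp

theorem integral_centred_sq (hX : Measurable X) (hM : Measurable M) (hY : Measurable Y)
    (hI : IsMCAR P X M Y) (hL : IsBalancedLDA P μ S X Y) (hB : IsBernoulliMissing P η M)
    (hS : S.PosDef) (k : ℤˣ) (j : Fin d) :
    Integrable (fun z => centred k j (μ k j) z ^ 2) (obsLabelLaw P X M Y) ∧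
    ∫ z, centred k j (μ k j) z ^ 2 ∂obsLabelLaw P X M Y = S j j * ((1 - η) / 2) := by
  have hm : Measurable fun z => centred k j (μ k j) z ^ 2 := (measurable_centred k j _).pow_const 2
  have hfun : ∀ ω, centred k j (μ k j) (observe X M ω, Y ω) ^ 2
      = obsInd j (M ω) * classDev k j (μ k j) (X ω, Y ω) ^ 2 := by
    intro ω
    rw [centred_observe, mul_pow]
    congr 1
    rw [obsInd]
    split_ifs <;> simp
  have hind : IndepFun (fun ω => obsInd j (M ω)) (fun ω => classDev k j (μ k j) (X ω, Y ω) ^ 2) P :=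
    hI.comp (measurable_obsInd j) ((measurable_classDev k j (μ k j)).pow_const 2)
  have hcm : AEStronglyMeasurable (fun ω => classDev k j (μ k j) (X ω, Y ω) ^ 2) P :=
    (((measurable_classDev k j (μ k j)).pow_const 2).comp (hX.prodMk hY)).aestronglyMeasurable
  have hcint : Integrable (fun ω => classDev k j (μ k j) (X ω, Y ω) ^ 2) P := by
    rw [classDev_sq_eq_indicator, integrable_indicator_iff (measurableSet_class hY k)]
    exact integrable_class hL hX hY k (f := fun x => (x j - μ k j) ^ 2)
      (memLp_eval_sub (μ k) j _).integrable_sq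
  constructor
  · rw [obsLabelLaw, integrable_map_measure hm.aestronglyMeasurable
      (measurable_obsLabel hX hM hY).aemeasurable]
    refine hcint.mono' (hm.comp (measurable_obsLabel hX hM hY)).aestronglyMeasurable
      (Filter.Eventually.of_forall fun ω => ?_)
    simp only [Function.comp, hfun]
    rw [Real.norm_of_nonneg (mul_nonneg (by rw [obsInd]; split_ifs <;> simp) (sq_nonneg _))]
    refine mul_le_of_le_one_left (sq_nonneg _) ?_
    rw [obsInd]
    split_ifs <;> simp
  · rw [obsLabelLaw, integral_map (measurable_obsLabel hX hM hY).aemeasurable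
      hm.aestronglyMeasurable]
    simp only [hfun]
    rw [hind.integral_fun_mul_eq_mul_integral
      ((measurable_obsInd j).comp hM).aestronglyMeasurable hcm, integral_obsInd hM hB,
      classDev_sq_eq_indicator, integral_indicator (measurableSet_class hY k),
      integral_class hL hY k (f := fun x => (x j - μ k j) ^ 2) (by fun_prop),
      integral_eval_sub_sq hS]
    ring

theorem measureReal_seen (hX : Measurable X) (hM : Measurable M) (hY : Measurable Y)
    (hI : IsMCAR P X M Y) (hL : IsBalancedLDA P μ S X Y) (hB : IsBernoulliMissing P η M)
    (k : ℤˣ) (j : Fin d) :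
    (obsLabelLaw P X M Y).real {z | z.2 = k ∧ z.1.1 j = false} = (1 - η) / 2 := by
  rw [obsLabelLaw, map_measureReal_apply (measurable_obsLabel hX hM hY) (measurableSet_seen k j)]
  have h : (fun ω => (observe X M ω, Y ω)) ⁻¹' {z | z.2 = k ∧ z.1.1 j = false}
      = M ⁻¹' {m | m j = false} ∩ (fun ω => (X ω, Y ω)) ⁻¹' {q | q.2 = k} := by
    ext ω
    simp [observe, and_comm]
  have h2 := hI.measure_inter_preimage_eq_mul {m | m j = false} {q | q.2 = k}
    (measurableSet_observed j)
    (measurable_snd (measurableSet_units_singleton k))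
  rw [h, measureReal_def, h2, ENNReal.toReal_mul, ← measureReal_def, ← measureReal_def]
  have h3 := measureReal_observed hM hB j
  have h4 := hL.measureReal_class hY k
  simp only [Set.preimage_ofPred_eq] at *
  rw [h3, h4]
  ring

theorem integral_seen (hX : Measurable X) (hM : Measurable M) (hY : Measurable Y)
    (hI : IsMCAR P X M Y) (hL : IsBalancedLDA P μ S X Y) (hB : IsBernoulliMissing P η M)
    (k : ℤˣ) (j : Fin d) :
    ∫ z, seen k j z ∂obsLabelLaw P X M Y = (1 - η) / 2 := by
  rw [← measureReal_seen hX hM hY hI hL hB k j, ← integral_indicator_one (measurableSet_seen k j)]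
  congr 1 with z
  simp [seen, Set.indicator_apply]

/-- The error of `muHat` splits into the error `a` of an empty average and a centred average. -/
theorem sq_sub_muHat (D : Fin n → MaskedObs d × ℤˣ) (k : ℤˣ) (j : Fin d) (a : ℝ) :
    (a - muHat D k j) ^ 2
      = a ^ 2 * {D : Fin n → MaskedObs d × ℤˣ | ∀ i, D i ∈
            {z : MaskedObs d × ℤˣ | z.2 = k ∧ z.1.1 j = false}ᶜ}.indicator 1 D
        + ((∑ i, centred k j a (D i)) / ∑ i, seen k j (D i)) ^ 2 := by
  by_cases h : ∀ i, D i ∈ {z : MaskedObs d × ℤˣ | z.2 = k ∧ z.1.1 j = false}ᶜ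
  · have h0 : ∀ i, seen k j (D i) = 0 := fun i => if_neg (h i)
    rw [Set.indicator_of_mem (by exact h), muHat_eq]
    simp [h0]
  · rw [Set.indicator_of_notMem (by exact h), muHat_eq]
    have hpos : ∑ i, seen k j (D i) ≠ 0 := by
      push Not at h
      obtain ⟨i, hi⟩ := h
      have hi1 : seen k j (D i) = 1 := if_pos (by simpa using hi)
      have h0 : ∀ r, 0 ≤ seen k j (D r) := fun r => by
        rcases seen_eq_zero_or_one k j (D r) with h | h <;> simp [h]
      have := Finset.single_le_sum (fun r _ => h0 r) (Finset.mem_univ i)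
      intro h2
      rw [h2, hi1] at this
      linarith
    have hs : ∑ i, centred k j a (D i)
        = ∑ i, seen k j (D i) * zeroExtend (D i).1.1 (D i).1.2 j - (∑ i, seen k j (D i)) * a := by
      rw [Finset.sum_mul, ← Finset.sum_sub_distrib]
      exact Finset.sum_congr rfl fun i _ => by rw [centred]; ring
    rw [hs, sub_div, mul_div_cancel_left₀ _ hpos]
    ring

theorem isProbabilityMeasure_obsLabelLaw (hX : Measurable X) (hM : Measurable M)
    (hY : Measurable Y) : IsProbabilityMeasure (obsLabelLaw P X M Y) :=
  Measure.isProbabilityMeasure_map (measurable_obsLabel hX hM hY).aemeasurable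

/-- The mean squared error of `muHat`, weighted by the probability that a coordinate is observed. -/
theorem integral_sq_sub_muHat_le (hd : 0 < d) (hn : 0 < n) (hX : Measurable X) (hM : Measurable M)
    (hY : Measurable Y) (hI : IsMCAR P X M Y) (hL : IsBalancedLDA P μ S X Y)
    (hB : IsBernoulliMissing P η M) (hS : S.PosDef) (k : ℤˣ) (j : Fin d) :
    Integrable (fun D : Fin n → MaskedObs d × ℤˣ => (1 - η) * (μ k j - muHat D k j) ^ 2)
      (Measure.pi fun _ => obsLabelLaw P X M Y) ∧
    ∫ D : Fin n → MaskedObs d × ℤˣ, (1 - η) * (μ k j - muHat D k j) ^ 2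
      ∂(Measure.pi fun _ => obsLabelLaw P X M Y)
      ≤ (1 - η) * μ k j ^ 2 * ((1 + η) / 2) ^ n + 4 * S j j / n := by
  have hη := hB.mem_Icc hd
  have hSj : 0 < S j j := hS.diag_pos
  have hn' : (0 : ℝ) < n := Nat.cast_pos.mpr hn
  rcases hη.2.eq_or_lt with h1 | h1
  · subst h1
    simp only [sub_self, zero_mul, integral_zero]
    exact ⟨integrable_zero _ _ _, by positivity⟩
  have : IsProbabilityMeasure (obsLabelLaw P X M Y) := isProbabilityMeasure_obsLabelLaw hX hM hY
  set ρ := obsLabelLaw P X M Y with hρ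
  set τ := Measure.pi fun _ : Fin n => ρ with hτ
  have heval : ∀ i : Fin n, MeasurePreserving (fun D : Fin n → MaskedObs d × ℤˣ => D i) τ ρ :=
    fun i => measurePreserving_eval (fun _ => ρ) i
  have hint : ∀ (i : Fin n) {f : MaskedObs d × ℤˣ → ℝ}, Measurable f →
      ∫ D, f (D i) ∂τ = ∫ z, f z ∂ρ := by
    intro i f hf
    rw [← (heval i).map_eq, integral_map (heval i).aemeasurable hf.aestronglyMeasurable]
  have hp : 0 < (1 - η) / 2 := by linarith
  have hsq := integral_centred_sq hX hM hY hI hL hB hS k j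
  have hind : iIndepFun (fun (i : Fin n) (D : Fin n → MaskedObs d × ℤˣ) => D i) τ :=
    iIndepFun_pi (X := fun _ z => z) (fun _ => aemeasurable_id)
  obtain ⟨hI1, hI2⟩ := integral_sq_subsample_average_le hn hind (fun i => measurable_pi_apply i)
    (measurable_seen k j) (measurable_centred k j (μ k j)) (seen_eq_zero_or_one k j)
    (fun z hz => by rw [centred, hz, zero_mul]) hp hSj.le
    (fun i => by rw [hint i (measurable_seen k j), integral_seen hX hM hY hI hL hB])
    (fun i => by rw [hint i (measurable_centred k j _), integral_centred hX hM hY hI hL])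
    (fun i => by
      have hmi : Measurable fun D : Fin n → MaskedObs d × ℤˣ => centred k j (μ k j) (D i) :=
        (measurable_centred k j _).comp (measurable_pi_apply i)
      rw [memLp_two_iff_integrable_sq hmi.aestronglyMeasurable]
      exact (heval i).integrable_comp_of_integrable hsq.1)
    (fun i => by rw [hint i ((measurable_centred k j _).pow_const 2), hsq.2])
  set A : Set (MaskedObs d × ℤˣ) := {z | z.2 = k ∧ z.1.1 j = false} with hA
  have hAm : MeasurableSet A := measurableSet_seen k j
  have hEset : {D : Fin n → MaskedObs d × ℤˣ | ∀ i, D i ∈ Aᶜ} = Set.univ.pi fun _ => Aᶜ := by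
    ext D; simp
  have hEm : MeasurableSet {D : Fin n → MaskedObs d × ℤˣ | ∀ i, D i ∈ Aᶜ} := by
    rw [hEset]
    exact MeasurableSet.univ_pi fun _ => hAm.compl
  have hE : τ.real {D : Fin n → MaskedObs d × ℤˣ | ∀ i, D i ∈ Aᶜ} = ((1 + η) / 2) ^ n := by
    rw [hEset, measureReal_def, hτ, Measure.pi_pi, ENNReal.toReal_prod]
    simp only [← measureReal_def, Finset.prod_const, Finset.card_univ, Fintype.card_fin]
    rw [measureReal_compl hAm, probReal_univ, measureReal_seen hX hM hY hI hL hB]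
    congr 1
    ring
  have hEi : Integrable ({D : Fin n → MaskedObs d × ℤˣ | ∀ i, D i ∈ Aᶜ}.indicator
      (1 : (Fin n → MaskedObs d × ℤˣ) → ℝ)) τ :=
    (integrable_const (1 : ℝ)).indicator hEm
  simp only [sq_sub_muHat]
  refine ⟨((hEi.const_mul _).add hI1).const_mul _, ?_⟩
  rw [integral_const_mul, integral_add (hEi.const_mul _) hI1, integral_const_mul,
    integral_indicator_one hEm, hE]
  have h3 : (1 - η) * (2 * S j j / (n * ((1 - η) / 2))) = 4 * S j j / n := by
    have : 1 - η ≠ 0 := by linarith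
    field_simp
    ring
  rw [mul_add, ← mul_assoc, ← h3]
  gcongr

end MeanSquaredError

/-! ### The excess risk of the plug-in classifier -/

section PlugIn

variable {Ω : Type*} [MeasurableSpace Ω] {d n : ℕ} {P : Measure Ω} [IsProbabilityMeasure P]
  {X : Ω → EuclideanSpace ℝ (Fin d)} {M : Ω → Pattern d} {Y : Ω → ℤˣ}
  {D : Fin n → Ω → MaskedObs d × ℤˣ}
  {μ : ℤˣ → EuclideanSpace ℝ (Fin d)} {S : Matrix (Fin d) (Fin d) ℝ} {η : ℝ}

/-- The sample and the new labelled observation have a product law. -/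
theorem IsSample.map_eq (hD : IsSample P X M Y D) (hX : Measurable X) (hM : Measurable M)
    (hY : Measurable Y) :
    P.map (fun ω => ((fun i => D i ω), (observe X M ω, Y ω)))
      = (Measure.pi fun _ => obsLabelLaw P X M Y).prod (obsLabelLaw P X M Y) := by
  obtain ⟨h1, h2, h3⟩ := hD
  have hDm : ∀ i, AEMeasurable (D i) P := fun i => (h1 i).aemeasurable_fst
  rw [(indepFun_iff_map_prod_eq_prod_map_map (aemeasurable_pi_lambda _ hDm)
    (measurable_obsLabel hX hM hY).aemeasurable).mp h3,
    (iIndepFun_iff_map_fun_eq_pi_map hDm).mp h2]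
  simp only [fun i => (h1 i).map_eq]
  rfl

/-- If the plug-in rule built from any fixed sample has risk at most `c + F`, then its overall risk
is at most `c` plus the mean of `F` over the sample. -/
theorem plugInMissRisk_le (hD : IsSample P X M Y D) (hX : Measurable X) (hM : Measurable M)
    (hY : Measurable Y) {c : ℝ} {F : (Fin n → MaskedObs d × ℤˣ) → ℝ}
    (hF : Integrable F (Measure.pi fun _ => obsLabelLaw P X M Y))
    (h : ∀ A, P.real {ω | Y ω ≠ plugIn S A (observe X M ω)} ≤ c + F A) :
    plugInMissRisk P S X M Y D ≤ c + ∫ A, F A ∂(Measure.pi fun _ => obsLabelLaw P X M Y) := by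
  have : IsProbabilityMeasure (obsLabelLaw P X M Y) := isProbabilityMeasure_obsLabelLaw hX hM hY
  set ρ := obsLabelLaw P X M Y with hρ
  set τ := Measure.pi fun _ : Fin n => ρ with hτ
  set E : Set ((Fin n → MaskedObs d × ℤˣ) × (MaskedObs d × ℤˣ)) :=
    {q | q.2.2 ≠ plugIn S q.1 q.2.1} with hE
  have hEm : MeasurableSet E := by
    have h1 : Measurable fun q : (Fin n → MaskedObs d × ℤˣ) × (MaskedObs d × ℤˣ) =>
        plugIn S q.1 q.2.1 :=
      (measurable_plugIn S).comp (measurable_fst.prodMk (measurable_fst.comp measurable_snd))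
    have h2 : E = ⋃ k : ℤˣ, {q | q.2.2 = k} ∩ {q | plugIn S q.1 q.2.1 ≠ k} := by
      ext q
      simp [hE, eq_comm]
    rw [h2]
    exact MeasurableSet.iUnion fun k => MeasurableSet.inter
      ((measurable_snd.comp measurable_snd) (measurableSet_units_singleton k))
      (h1 (measurableSet_units {l | l ≠ k}))
  have hm : AEMeasurable (fun ω => ((fun i => D i ω), (observe X M ω, Y ω))) P :=
    (aemeasurable_pi_lambda _ fun i => (hD.1 i).aemeasurable_fst).prodMk
      (measurable_obsLabel hX hM hY).aemeasurable
  have hrisk : plugInMissRisk P S X M Y D = (τ.prod ρ).real E := by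
    rw [hτ, hρ, ← hD.map_eq hX hM hY, measureReal_def, Measure.map_apply_of_aemeasurable hm hEm]
    rfl
  have hfiber : ∀ A, ρ.real (Prod.mk A ⁻¹' E) = P.real {ω | Y ω ≠ plugIn S A (observe X M ω)} := by
    intro A
    rw [hρ, obsLabelLaw, map_measureReal_apply (measurable_obsLabel hX hM hY)
      (measurable_prodMk_left hEm)]
    rfl
  have hint : (τ.prod ρ).real E = ∫ A, ρ.real (Prod.mk A ⁻¹' E) ∂τ := by
    rw [measureReal_def, Measure.prod_apply hEm]
    simp only [measureReal_def]
    rw [integral_toReal (measurable_measure_prodMk_left hEm).aemeasurable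
      (Filter.Eventually.of_forall fun A => measure_lt_top _ _)]
  have hi : Integrable (fun A => ρ.real (Prod.mk A ⁻¹' E)) τ := by
    refine Integrable.of_bound
      (measurable_measure_prodMk_left hEm).ennreal_toReal.aestronglyMeasurable 1
      (Filter.Eventually.of_forall fun A => ?_)
    rw [Real.norm_of_nonneg measureReal_nonneg]
    exact measureReal_le_one
  calc plugInMissRisk P S X M Y D = ∫ A, ρ.real (Prod.mk A ⁻¹' E) ∂τ := hrisk.trans hint
    _ ≤ ∫ A, (c + F A) ∂τ := by
        refine integral_mono hi ((integrable_const c).add hF) fun A => ?_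
        change ρ.real (Prod.mk A ⁻¹' E) ≤ c + F A
        rw [hfiber]
        exact h A
    _ = c + ∫ A, F A ∂τ := by
        rw [integral_add (integrable_const c) hF]
        simp

theorem abs_le_supMean (k : ℤˣ) (j : Fin d) : |μ k j| ≤ supMean μ :=
  le_ciSup (f := fun p : ℤˣ × Fin d => |μ p.1 p.2|) (Set.finite_range _).bddAbove (k, j)

theorem kappa_pos (hd : 0 < d) (hS : S.PosDef) : 0 < kappa S := by
  refine div_pos (lt_of_lt_of_le (hS.diag_pos (i := ⟨0, hd⟩)) ?_) (lambdaMin_pos hd hS)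
  exact le_ciSup (f := fun j => S j j) (Set.finite_range _).bddAbove ⟨0, hd⟩

/-- The quantity under the square root in the bound on the excess risk. -/
def excessBound (μ : ℤˣ → EuclideanSpace ℝ (Fin d)) (S : Matrix (Fin d) (Fin d) ℝ) (η : ℝ)
    (n : ℕ) : ℝ :=
  ((1 + η) / 2) ^ n * (supMean μ ^ 2 * d * (1 - η) / lambdaMin S) + 4 * kappa S * d / n

theorem plugInMissRisk_sub_bayesMissRisk_le (hd : 0 < d) (hn : 0 < n) (hS : S.PosDef)
    (hX : Measurable X) (hM : Measurable M) (hY : Measurable Y) (hI : IsMCAR P X M Y)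
    (hL : IsBalancedLDA P μ S X Y) (hB : IsBernoulliMissing P η M) (hD : IsSample P X M Y D) :
    plugInMissRisk P S X M Y D - bayesMissRisk P X M Y
      ≤ 2 / Real.sqrt (2 * Real.pi) * Real.sqrt (excessBound μ S η n) := by
  have hη := hB.mem_Icc hd
  have hl := lambdaMin_pos hd hS
  have hpi : 0 < Real.sqrt (2 * Real.pi) := by positivity
  have hκ := kappa_pos hd hS
  have hn' : (0 : ℝ) < n := Nat.cast_pos.mpr hn
  have hd' : (0 : ℝ) < d := Nat.cast_pos.mpr hd
  have hη1 : 0 ≤ 1 - η := by linarith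
  have hη2 : 0 ≤ (1 + η) / 2 := by linarith
  have hBpos : 0 < excessBound μ S η n := by
    rw [excessBound]
    positivity
  set t := Real.sqrt (excessBound μ S η n) with htdef
  have ht : 0 < t := Real.sqrt_pos.mpr hBpos
  have htt : t ^ 2 = excessBound μ S η n := Real.sq_sqrt hBpos.le
  set τ := Measure.pi fun _ : Fin n => obsLabelLaw P X M Y with hτ
  have : IsProbabilityMeasure (obsLabelLaw P X M Y) := isProbabilityMeasure_obsLabelLaw hX hM hY
  have hmse := integral_sq_sub_muHat_le hd hn hX hM hY hI hL hB hS
  -- the total squared error in one class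
  set W : ℤˣ → (Fin n → MaskedObs d × ℤˣ) → ℝ :=
    fun k A => (1 - η) * ∑ j, (μ k j - muHat A k j) ^ 2 with hW
  have hWi : ∀ k, Integrable (W k) τ := by
    intro k
    simp only [hW, Finset.mul_sum]
    exact integrable_finsetSum _ fun j _ => (hmse k j).1
  have hWle : ∀ k, ∫ A, W k A ∂τ ≤ lambdaMin S * t ^ 2 := by
    intro k
    simp only [hW, Finset.mul_sum]
    rw [integral_finsetSum _ fun j _ => (hmse k j).1, htt]
    have h1 : ∀ j, ∫ A, (1 - η) * (μ k j - muHat A k j) ^ 2 ∂τ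
        ≤ (1 - η) * supMean μ ^ 2 * ((1 + η) / 2) ^ n + 4 * (⨆ j, S j j) / n := by
      intro j
      refine (hmse k j).2.trans ?_
      have h2 : μ k j ^ 2 ≤ supMean μ ^ 2 := sq_le_sq' (neg_le_of_abs_le (abs_le_supMean k j))
        (le_of_abs_le (abs_le_supMean k j))
      have h3 : S j j ≤ ⨆ j, S j j :=
        le_ciSup (f := fun j => S j j) (Set.finite_range _).bddAbove j
      gcongr
    refine (Finset.sum_le_sum fun j _ => h1 j).trans (le_of_eq ?_)
    rw [Finset.sum_const, Finset.card_univ, Fintype.card_fin, nsmul_eq_mul, excessBound, kappa]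
    field_simp
  have hF : Integrable (fun A => ((W 1 A + W (-1) A) / (2 * t * lambdaMin S) + t)
      / Real.sqrt (2 * Real.pi)) τ :=
    ((((hWi 1).add (hWi (-1))).div_const _).add (integrable_const t)).div_const _
  have hrisk : plugInMissRisk P S X M Y D ≤ ldaRisk P M μ S (fun k => μ k)
      + ∫ A, ((W 1 A + W (-1) A) / (2 * t * lambdaMin S) + t) / Real.sqrt (2 * Real.pi) ∂τ := by
    refine plugInMissRisk_le hD hX hM hY hF fun A => ?_
    have h1 := ldaRisk_sub_le (μ := μ) hd hM hB hS (muHat A) ht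
    have h2 := risk_ldaRule hX hM hY hI hL hS (muHat A)
    rw [plugIn, h2]
    linarith
  have hval : ∫ A, ((W 1 A + W (-1) A) / (2 * t * lambdaMin S) + t) / Real.sqrt (2 * Real.pi) ∂τ
      ≤ 2 / Real.sqrt (2 * Real.pi) * t := by
    have hsum : Integrable (fun A => (W 1 A + W (-1) A) / (2 * t * lambdaMin S)) τ :=
      ((hWi 1).add (hWi (-1))).div_const _
    rw [integral_div, integral_add hsum (integrable_const t),
      integral_div, integral_add (hWi 1) (hWi (-1)), integral_const, probReal_univ, one_smul,
      div_mul_eq_mul_div]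
    refine div_le_div_of_nonneg_right ?_ hpi.le
    have h1 : (∫ A, W 1 A ∂τ + ∫ A, W (-1) A ∂τ) / (2 * t * lambdaMin S) ≤ t := by
      rw [div_le_iff₀ (by positivity)]
      have := hWle 1
      have := hWle (-1)
      nlinarith
    linarith
  have hbayes := ldaRisk_le_bayesMissRisk hX hM hY hI hL hS
  linarith

/-- The exponentially small term in the bound is eventually dominated by the `1 / n` term. -/
theorem exists_excessBound_le (hd : 0 < d) (hS : S.PosDef) (hη : 0 ≤ η ∧ η ≤ 1) :
    ∃ N : ℕ, 0 < N ∧ ∀ n, N ≤ n → excessBound μ S η n ≤ 5 * (kappa S * d / n) := by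
  have hκ : 0 < kappa S * d := mul_pos (kappa_pos hd hS) (Nat.cast_pos.mpr hd)
  set c := supMean μ ^ 2 * d * (1 - η) / lambdaMin S with hc
  have hlim : Filter.Tendsto (fun n : ℕ => (n : ℝ) * ((1 + η) / 2) ^ n * c) Filter.atTop
      (nhds 0) := by
    rcases hη.2.eq_or_lt with h | h
    · have h0 : c = 0 := by simp [hc, h]
      simp [h0]
    · have := (tendsto_self_mul_const_pow_of_lt_one (r := (1 + η) / 2) (by linarith)
        (by linarith)).mul_const c
      simpa using this
  obtain ⟨N, hN⟩ := Filter.eventually_atTop.mp (hlim.eventually_lt_const hκ)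
  refine ⟨N + 1, Nat.succ_pos N, fun n hn => ?_⟩
  have hn0 : (0 : ℝ) < n := Nat.cast_pos.mpr (by omega)
  have h1 := hN n (by omega)
  have h2 : ((1 + η) / 2) ^ n * c ≤ kappa S * d / n := by
    rw [le_div_iff₀ hn0]
    linarith
  have h3 : 4 * kappa S * d / n = 4 * (kappa S * d / n) := by ring
  rw [excessBound, h3]
  linarith

end PlugIn

end MissingLDA

end

theorem mainTheorem1 :
    (∀ (d n : ℕ) (_ : 0 < d) (_ : 0 < n) (μ : ℤˣ → EuclideanSpace ℝ (Fin d))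
        (S : Matrix (Fin d) (Fin d) ℝ) (_ : S.PosDef) (η : ℝ)
        (Ω : Type*) [MeasurableSpace Ω] (P : Measure Ω) [IsProbabilityMeasure P]
        (X : Ω → EuclideanSpace ℝ (Fin d)) (M : Ω → Pattern d) (Y : Ω → ℤˣ)
        (D : Fin n → Ω → MaskedObs d × ℤˣ),
        Measurable X → Measurable M → Measurable Y →
        IsMCAR P X M Y → IsBalancedLDA P μ S X Y → IsBernoulliMissing P η M →
        IsSample P X M Y D →
        plugInMissRisk P S X M Y D - bayesMissRisk P X M Y ≤
          2 / Real.sqrt (2 * Real.pi) *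
            Real.sqrt (((1 + η) / 2) ^ n * (supMean μ ^ 2 * d * (1 - η) / lambdaMin S)
              + 4 * kappa S * d / n)) ∧
    (∃ C : ℝ, 0 < C ∧
      ∀ (d : ℕ) (_ : 0 < d) (μ : ℤˣ → EuclideanSpace ℝ (Fin d))
        (S : Matrix (Fin d) (Fin d) ℝ) (_ : S.PosDef) (η : ℝ),
        ∃ N : ℕ, ∀ n : ℕ, N ≤ n →
          ∀ (Ω : Type*) [MeasurableSpace Ω] (P : Measure Ω) [IsProbabilityMeasure P]
            (X : Ω → EuclideanSpace ℝ (Fin d)) (M : Ω → Pattern d) (Y : Ω → ℤˣ)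
            (D : Fin n → Ω → MaskedObs d × ℤˣ),
            Measurable X → Measurable M → Measurable Y →
            IsMCAR P X M Y → IsBalancedLDA P μ S X Y → IsBernoulliMissing P η M →
            IsSample P X M Y D →
            plugInMissRisk P S X M Y D - bayesMissRisk P X M Y ≤
              C * Real.sqrt (kappa S * d / n)) := by
  refine ⟨?_, 2 / Real.sqrt (2 * Real.pi) * Real.sqrt 5, by positivity, ?_⟩
  · intro d n hd hn μ S hS η Ω _ P _ X M Y D hX hM hY hI hL hB hD
    exact plugInMissRisk_sub_bayesMissRisk_le hd hn hS hX hM hY hI hL hB hD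
  · intro d hd μ S hS η
    by_cases hη : 0 ≤ η ∧ η ≤ 1
    · obtain ⟨N, hN0, hN⟩ := exists_excessBound_le (μ := μ) hd hS hη
      refine ⟨N, fun n hn Ω _ P _ X M Y D hX hM hY hI hL hB hD => ?_⟩
      refine (plugInMissRisk_sub_bayesMissRisk_le hd (hN0.trans_le hn) hS hX hM hY hI hL hB
        hD).trans ?_
      rw [mul_assoc, ← Real.sqrt_mul (by norm_num)]
      exact mul_le_mul_of_nonneg_left (Real.sqrt_le_sqrt (hN n hn)) (by positivity)
    -- a missingness probability lies in `[0, 1]`, so there is no model for any other `η`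
    · exact ⟨0, fun n _ Ω _ P _ X M Y D _ _ _ _ _ hB _ => absurd (hB.mem_Icc hd) hη⟩
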